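/- Let $M$ be a connected Hausdorff $C^\infty$ manifold of dimension $n\ge 2$, and let $F:TM\to[0,\infty)$ be a Finsler structure: $F$ is $C^\infty$ on the set $TM_0$ of nonzero tangent vectors, $F(x,\lambda y)=\lambda F(x,y)$ for all $\lambda>0$, and the matrix $g_{ij}=\left[\tfrac12F^2\right]_{y^iy^j}$ is positive definite on $TM_0$ ($F$ need not be reversible). In local coordinates $(x,y)$ on $TM$ (repeated indices are summed) let $$G^i=\tfrac12 g^{il}\left([F^2]_{x^ky^l}y^k-[F^2]_{x^l}\right),\qquad F^2\,Ric=\tfrac12\left(2(G^i)_{x^i}-\tfrac12(G^i)_{y^j}(G^j)_{y^i}-y^j(G^i)_{y^ix^j}+G^j(G^i)_{y^iy^j}\right),$$ and let $Ric_{ij}=\tfrac12\left[F^2\,Ric\right]_{y^iy^j}$ be the Ricci tensor. A geodesic parametrized by arc length $s$ is a smooth curve $x(s)$ with $F(x,x')=1$ and $x''^{\,i}+G^i(x,x')=0$. A smooth parameter $p=p(s)$ with $p'\ne0$ along such a geodesic is called projective if $$\frac{p'''}{p'}-\frac32\left(\frac{p''}{p'}\right)^2=\frac{2}{n-1}\,Ric_{jk}(x,x')\,x'^{\,j}x'^{\,k}.$$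 A map $f:I=(-1,1)\to M$ is called projective if $f(p(s))=x(s)$ for some arc length parametrized geodesic $x$ defined on an open interval $J$ and some projective parameter $p$ of it that maps $J$ bijectively onto $I$. Let $\rho(a,b)=\left|\ln\frac{(1-a)(1+b)}{(1-b)(1+a)}\right|$ be the Poincaré distance on $I$, and for $x,y\in M$ let $$d_M(x,y)=\inf\sum_{i=1}^k\rho(a_i,b_i),$$ where the infimum is over all $k\ge1$, points $x=x_0,x_1,\dots,x_k=y$ of $M$, pairs $a_i,b_i\in I$ and projective maps $f_i:I\to M$ with $f_i(a_i)=x_{i-1}$ and $f_i(b_i)=x_i$ for $i=1,\dots,k$. Suppose that for some constant $c>0$ we have $Ric_{ij}\le -c^2g_{ij}$ as matrices, at every point of $TM_0$. Then $d_M$ is a distance on $M$: for all $x,y,z\in M$, $d_M(x,y)$ is finite, $d_M(x,y)=0$ if and only if $x=y$, $d_M(x,y)=d_M(y,x)$, and $d_M(x,z)\le d_M(x,y)+d_M(y,z)$. -/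

import Mathlib

open scoped Manifold ContDiff Topology ENNReal

noncomputable section

namespace Finsler

/-! ### Coordinate expressions on a domain of `ℝⁿ × ℝⁿ`, with coordinates `(x, y)` -/

section Coordinates

variable {n : ℕ}

/-- The partial derivative `∂Φ/∂xⁱ` of a function `Φ(x, y)`. -/
def pderivX (i : Fin n) (Φ : EuclideanSpace ℝ (Fin n) × EuclideanSpace ℝ (Fin n) → ℝ)
    (z : EuclideanSpace ℝ (Fin n) × EuclideanSpace ℝ (Fin n)) : ℝ :=
  fderiv ℝ Φ z (EuclideanSpace.single i 1, 0)

/-- The partial derivative `∂Φ/∂yⁱ` of a function `Φ(x, y)`. -/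
def pderivY (i : Fin n) (Φ : EuclideanSpace ℝ (Fin n) × EuclideanSpace ℝ (Fin n) → ℝ)
    (z : EuclideanSpace ℝ (Fin n) × EuclideanSpace ℝ (Fin n)) : ℝ :=
  fderiv ℝ Φ z (0, EuclideanSpace.single i 1)

/-- The fundamental tensor `g_{ij} = [F²/2]_{yⁱyʲ}` of a function `F(x, y)`. -/
def fundamentalTensor (F : EuclideanSpace ℝ (Fin n) × EuclideanSpace ℝ (Fin n) → ℝ)
    (z : EuclideanSpace ℝ (Fin n) × EuclideanSpace ℝ (Fin n)) : Matrix (Fin n) (Fin n) ℝ :=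
  Matrix.of fun i j => pderivY j (pderivY i fun w => 1 / 2 * F w ^ 2) z

/-- The spray coefficients `Gⁱ = ½ g^{il} ([F²]_{xᵏyˡ} yᵏ - [F²]_{xˡ})`, normalized so that
the geodesic equation is `x'' + G(x, x') = 0`. -/
def spray (F : EuclideanSpace ℝ (Fin n) × EuclideanSpace ℝ (Fin n) → ℝ) (i : Fin n)
    (z : EuclideanSpace ℝ (Fin n) × EuclideanSpace ℝ (Fin n)) : ℝ :=
  1 / 2 * ∑ l, (fundamentalTensor F z)⁻¹ i l *
    ((∑ k, pderivY l (pderivX k fun w => F w ^ 2) z * z.2 k) - pderivX l (fun w => F w ^ 2) z)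

/-- The Riemann curvature `F² Rⁱₖ`, homogeneous of degree two in `y`:
`2 F² Rⁱₖ = 2 (Gⁱ)_{xᵏ} - ½ (Gⁱ)_{yʲ} (Gʲ)_{yᵏ} - yʲ (Gⁱ)_{yᵏxʲ} + Gʲ (Gⁱ)_{yᵏyʲ}`. -/
def riemannCurvature (F : EuclideanSpace ℝ (Fin n) × EuclideanSpace ℝ (Fin n) → ℝ)
    (i k : Fin n) (z : EuclideanSpace ℝ (Fin n) × EuclideanSpace ℝ (Fin n)) : ℝ :=
  1 / 2 * (2 * pderivX k (spray F i) z
    - 1 / 2 * (∑ j, pderivY j (spray F i) z * pderivY k (spray F j) z)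
    - (∑ j, z.2 j * pderivX j (pderivY k (spray F i)) z)
    + ∑ j, spray F j z * pderivY j (pderivY k (spray F i)) z)

/-- Akbar-Zadeh's Ricci tensor `Ric_{ik} = ½ (F² Ric)_{yⁱyᵏ}`, where `F² Ric = F² Rʲⱼ`. -/
def ricciTensor (F : EuclideanSpace ℝ (Fin n) × EuclideanSpace ℝ (Fin n) → ℝ)
    (z : EuclideanSpace ℝ (Fin n) × EuclideanSpace ℝ (Fin n)) : Matrix (Fin n) (Fin n) ℝ :=
  Matrix.of fun i k => 1 / 2 * pderivY k (pderivY i fun w => ∑ j, riemannCurvature F j j w) z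

end Coordinates

/-! ### Finsler structures on manifolds -/

section Manifold

variable {n : ℕ} {M : Type*} [TopologicalSpace M] [ChartedSpace (EuclideanSpace ℝ (Fin n)) M]
  [IsManifold (𝓡 n) ∞ M]

/-- The expression `F(x, y) = F(yⁱ ∂/∂xⁱ)` of a function on the tangent bundle in the
local coordinates given by a chart `e` (meaningful for `x ∈ e.target`). -/
def inChart (F : TangentBundle (𝓡 n) M → ℝ)
    (e : OpenPartialHomeomorph M (EuclideanSpace ℝ (Fin n)))
    (z : EuclideanSpace ℝ (Fin n) × EuclideanSpace ℝ (Fin n)) : ℝ :=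
  F ⟨e.symm z.1, mfderiv (𝓡 n) (𝓡 n) e.symm z.1 z.2⟩

variable (n M) in
/-- A (globally defined) Finsler structure on the manifold `M`. -/
structure FinslerStructure where
  /-- The Finsler function on the tangent bundle. -/
  toFun : TangentBundle (𝓡 n) M → ℝ
  nonneg : ∀ v, 0 ≤ toFun v
  /-- `F` is smooth on the slit tangent bundle. -/
  smooth : ContMDiffOn (𝓡 n).tangent 𝓘(ℝ, ℝ) ∞ toFun {v | v.2 ≠ 0}
  homogeneous : ∀ (x : M) (y : TangentSpace (𝓡 n) x) (t : ℝ), 0 < t →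
    toFun ⟨x, t • y⟩ = t * toFun ⟨x, y⟩
  /-- In local coordinates, `(g_{ij}(x, y))` is positive definite whenever `y ≠ 0`. -/
  strongly_convex : ∀ e ∈ IsManifold.maximalAtlas (𝓡 n) ∞ M, ∀ x ∈ e.target,
    ∀ y : EuclideanSpace ℝ (Fin n), y ≠ 0 →
      (fundamentalTensor (inChart toFun e) (x, y)).PosDef

/-- `Ric_{ij} ≤ κ g_{ij}` as matrices, at every nonzero tangent vector, in all local
coordinates. -/
def RicciLE (F : FinslerStructure n M) (κ : ℝ) : Prop :=
  ∀ e ∈ IsManifold.maximalAtlas (𝓡 n) ∞ M, ∀ x ∈ e.target,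
    ∀ y : EuclideanSpace ℝ (Fin n), y ≠ 0 →
      (κ • fundamentalTensor (inChart F.toFun e) (x, y)
        - ricciTensor (inChart F.toFun e) (x, y)).PosSemidef

/-- The curve `γ`, restricted to the open interval `J`, is a geodesic parametrized by arc
length. The equation `x'' + G(x, x') = 0` is invariant under changes of coordinates, so that
it is enough to have it, at each parameter value, in some chart around the point. -/
structure IsArcLengthGeodesicOn (F : FinslerStructure n M) (γ : ℝ → M) (J : Set ℝ) : Prop where
  smooth : ContMDiffOn 𝓘(ℝ, ℝ) (𝓡 n) ∞ γ J
  unit_speed : ∀ s ∈ J, F.toFun ⟨γ s, mfderiv 𝓘(ℝ, ℝ) (𝓡 n) γ s (1 : ℝ)⟩ = 1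
  geodesic : ∀ s ∈ J, ∃ e ∈ IsManifold.maximalAtlas (𝓡 n) ∞ M, γ s ∈ e.source ∧
    ∀ i, deriv (deriv (e ∘ γ)) s i
      + spray (inChart F.toFun e) i (e (γ s), deriv (e ∘ γ) s) = 0

/-- The Schwarzian derivative `{p, s} = p'''/p' - (3/2) (p''/p')²`. -/
def schwarzian (p : ℝ → ℝ) (s : ℝ) : ℝ :=
  deriv (deriv (deriv p)) s / deriv p s - 3 / 2 * (deriv (deriv p) s / deriv p s) ^ 2

/-- `p` is a projective parameter of the geodesic `γ`, whose arc length parameter `s` runs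
over the open interval `J`: it is a regular change of parameter and
`{p, s} = 2/(n-1) Ric_{jk}(x, x') x'ʲ x'ᵏ`. The right hand side does not depend on the
coordinates, so that it may be computed in any chart around the point. -/
structure IsProjectiveParameterOn (F : FinslerStructure n M) (γ : ℝ → M) (J : Set ℝ)
    (p : ℝ → ℝ) : Prop where
  smooth : ContDiffOn ℝ ∞ p J
  deriv_ne_zero : ∀ s ∈ J, deriv p s ≠ 0
  schwarzian_eq : ∀ s ∈ J, ∃ e ∈ IsManifold.maximalAtlas (𝓡 n) ∞ M, γ s ∈ e.source ∧
    schwarzian p s = 2 / ((n : ℝ) - 1) *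
      ∑ j, ∑ k, ricciTensor (inChart F.toFun e) (e (γ s), deriv (e ∘ γ) s) j k
        * deriv (e ∘ γ) s j * deriv (e ∘ γ) s k

/-- `f : I → M`, with `I = (-1, 1)`, is a projective map: a geodesic for which the natural
parameter `u = p(s)` of `I` is a projective parameter. Only the values of `f` on `I` matter. -/
def IsProjectiveMap (F : FinslerStructure n M) (f : ℝ → M) : Prop :=
  ∃ (J : Set ℝ) (γ : ℝ → M) (p : ℝ → ℝ), IsOpen J ∧ J.OrdConnected ∧
    IsArcLengthGeodesicOn F γ J ∧ IsProjectiveParameterOn F γ J p ∧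
    Set.BijOn p J (Set.Ioo (-1) 1) ∧ ∀ s ∈ J, f (p s) = γ s

/-- The Poincaré distance on `I = (-1, 1)`. -/
def poincareDist (a b : ℝ) : ℝ :=
  |Real.log (((1 - a) * (1 + b)) / ((1 - b) * (1 + a)))|

/-- A chain of `k ≥ 1` geodesic segments from `x` to `y`: points `x = x₀, …, x_k = y`, pairs
`aᵢ, bᵢ` in `I = (-1, 1)` and projective maps `fᵢ` with `fᵢ(aᵢ) = xᵢ`, `fᵢ(bᵢ) = xᵢ₊₁`
(`0 ≤ i < k`). -/
structure GeodesicChain (F : FinslerStructure n M) (x y : M) where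
  k : ℕ
  one_le : 1 ≤ k
  point : ℕ → M
  a : ℕ → ℝ
  b : ℕ → ℝ
  f : ℕ → ℝ → M
  point_zero : point 0 = x
  point_last : point k = y
  a_mem : ∀ i < k, a i ∈ Set.Ioo (-1 : ℝ) 1
  b_mem : ∀ i < k, b i ∈ Set.Ioo (-1 : ℝ) 1
  projective : ∀ i < k, IsProjectiveMap F (f i)
  map_a : ∀ i < k, f i (a i) = point i
  map_b : ∀ i < k, f i (b i) = point (i + 1)

/-- The length `∑ ρ(aᵢ, bᵢ)` of a chain. -/
def GeodesicChain.length {F : FinslerStructure n M} {x y : M} (α : GeodesicChain F x y) : ℝ :=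
  ∑ i ∈ Finset.range α.k, poincareDist (α.a i) (α.b i)

/-- The pseudo-distance `d_M(x, y)`: the infimum of the lengths of all chains of geodesic
segments from `x` to `y` (`∞` if there were no chain). -/
def pseudoDist (F : FinslerStructure n M) (x y : M) : ℝ≥0∞ :=
  ⨅ α : GeodesicChain F x y, ENNReal.ofReal α.length

end Manifold

end Finsler

end

/-! Finiteness comes from local existence of projective arcs and connectedness; separation of points
comes from a Schwarz lemma.

Finiteness. With a = p''/p' and Q = 2/(n-1) Ric_{jk} x'ʲ x'ᵏ, the Schwarzian equation becomes the
Riccati equation a' = Q + a²/2, so a geodesic and its projective parameter together solve one smooth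
ODE. On a short arc, an affine change of p, which leaves the Schwarzian unchanged, makes the image
(-1, 1). Since F is smooth only off the zero section, the exponential map at zero velocity is
avoided: `exists_shooting` starts at x₁ = x₀ - T y₀, slightly behind x₀, and varies the velocity v
near a fixed y₀ ≠ 0. The end point depends on v like T v up to an error with Lipschitz constant
O(T²), hence covers a neighbourhood of x₀. Points near x₀ are thus joined to x₀ through x₁.
Reversibility of F plays no role, because the parameters aᵢ, bᵢ of a segment come in either order.

Separation. The Ricci bound makes the Schwarzian of every projective parameter at most -k²/2, where
k = 2c/√(n-1). For p' > 0, a maximum principle for (r² - p²)/p' (`mul_sq_le_of_schwarzian_le`)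
yields k(1 - p²) ≤ 2p'. Since 2p'/(1 - p²) is the derivative of log((1 + p)/(1 - p)), the Poincaré
distance is at least k times arc length. A bump function that is 1 at x and 0 at y is Lipschitz
along all unit speed geodesics with a common constant (`exists_bump_lipschitz`), so every chain from
x to y has length bounded below. -/

noncomputable section

namespace Finsler

/-! ### Homogeneity, smoothness and the geodesic spray in coordinates -/

section CoordinateCalculus

variable {n : ℕ}

/-- Phase space points `(x, y)` with `x ∈ U` and `y ≠ 0`. -/
def slit (U : Set (EuclideanSpace ℝ (Fin n))) :
    Set (EuclideanSpace ℝ (Fin n) × EuclideanSpace ℝ (Fin n)) :=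
  {z | z.1 ∈ U ∧ z.2 ≠ 0}

theorem isOpen_slit {U : Set (EuclideanSpace ℝ (Fin n))} (hU : IsOpen U) : IsOpen (slit U) :=
  (hU.preimage continuous_fst).inter (isOpen_ne.preimage continuous_snd)

theorem smul_mem_slit {U : Set (EuclideanSpace ℝ (Fin n))}
    {z : EuclideanSpace ℝ (Fin n) × EuclideanSpace ℝ (Fin n)} (hz : z ∈ slit U) {t : ℝ}
    (ht : 0 < t) : (z.1, t • z.2) ∈ slit U :=
  ⟨hz.1, smul_ne_zero ht.ne' hz.2⟩

theorem contDiffOn_pderivX {S : Set (EuclideanSpace ℝ (Fin n) × EuclideanSpace ℝ (Fin n))}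
    (hS : IsOpen S) {Φ : EuclideanSpace ℝ (Fin n) × EuclideanSpace ℝ (Fin n) → ℝ}
    (hΦ : ContDiffOn ℝ ∞ Φ S) (i : Fin n) : ContDiffOn ℝ ∞ (pderivX i Φ) S :=
  (hΦ.fderiv_of_isOpen hS (m := ∞) (by simp)).clm_apply contDiffOn_const

theorem contDiffOn_pderivY {S : Set (EuclideanSpace ℝ (Fin n) × EuclideanSpace ℝ (Fin n))}
    (hS : IsOpen S) {Φ : EuclideanSpace ℝ (Fin n) × EuclideanSpace ℝ (Fin n) → ℝ}
    (hΦ : ContDiffOn ℝ ∞ Φ S) (i : Fin n) : ContDiffOn ℝ ∞ (pderivY i Φ) S :=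
  (hΦ.fderiv_of_isOpen hS (m := ∞) (by simp)).clm_apply contDiffOn_const

/-- `Φ` is positively homogeneous of degree `k` in `y` over `U`. -/
def IsPosHomogeneous (U : Set (EuclideanSpace ℝ (Fin n))) (k : ℕ)
    (Φ : EuclideanSpace ℝ (Fin n) × EuclideanSpace ℝ (Fin n) → ℝ) : Prop :=
  ∀ z ∈ slit U, ∀ t : ℝ, 0 < t → Φ (z.1, t • z.2) = t ^ k * Φ z

theorem sum_smul_single (y : EuclideanSpace ℝ (Fin n)) :
    ∑ i, y i • EuclideanSpace.single i (1 : ℝ) = y := by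
  ext j
  simp [Finset.sum_apply, Pi.single_apply]

theorem fderiv_apply_eq_sum {Φ : EuclideanSpace ℝ (Fin n) × EuclideanSpace ℝ (Fin n) → ℝ}
    (z : EuclideanSpace ℝ (Fin n) × EuclideanSpace ℝ (Fin n)) (u v : EuclideanSpace ℝ (Fin n)) :
    fderiv ℝ Φ z (u, v) = ∑ i, u i * pderivX i Φ z + ∑ i, v i * pderivY i Φ z := by
  have h : (u, v) = (∑ i, u i • (EuclideanSpace.single i (1 : ℝ), (0 : EuclideanSpace ℝ (Fin n))))
      + ∑ i, v i • ((0 : EuclideanSpace ℝ (Fin n)), EuclideanSpace.single i (1 : ℝ)) := by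
    ext1
    · simp [Prod.fst_sum, sum_smul_single]
    · simp [Prod.snd_sum, sum_smul_single]
  rw [h]
  simp only [map_add, map_sum, map_smul, smul_eq_mul, pderivX, pderivY]

theorem hasFDerivAt_scale (t : ℝ) (z : EuclideanSpace ℝ (Fin n) × EuclideanSpace ℝ (Fin n)) :
    HasFDerivAt (fun w : EuclideanSpace ℝ (Fin n) × EuclideanSpace ℝ (Fin n) => (w.1, t • w.2))
      ((ContinuousLinearMap.fst ℝ _ _).prod (t • ContinuousLinearMap.snd ℝ _ _)) z :=
  hasFDerivAt_fst.prodMk (hasFDerivAt_snd.const_smul t)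

/-- Differentiate Φ(x, t y) = tᵏ Φ(x, y) in (x, y). Taking v = 0 or u = 0 shows that x-derivatives
keep the degree and y-derivatives lower it by one. -/
theorem IsPosHomogeneous.fderiv_scale {U : Set (EuclideanSpace ℝ (Fin n))} (hU : IsOpen U) {k : ℕ}
    {Φ : EuclideanSpace ℝ (Fin n) × EuclideanSpace ℝ (Fin n) → ℝ} (h : IsPosHomogeneous U k Φ)
    (hΦ : ContDiffOn ℝ ∞ Φ (slit U))
    {z : EuclideanSpace ℝ (Fin n) × EuclideanSpace ℝ (Fin n)} (hz : z ∈ slit U) {t : ℝ}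
    (ht : 0 < t) (u v : EuclideanSpace ℝ (Fin n)) :
    fderiv ℝ Φ (z.1, t • z.2) (u, t • v) = t ^ k * fderiv ℝ Φ z (u, v) := by
  have hd : ∀ w ∈ slit U, DifferentiableAt ℝ Φ w := fun w hw =>
    (hΦ.contDiffAt ((isOpen_slit hU).mem_nhds hw)).differentiableAt (by simp)
  have h1 := (hd _ (smul_mem_slit hz ht)).hasFDerivAt.comp z (hasFDerivAt_scale t z)
  have h2 := (hd z hz).hasFDerivAt.const_mul (t ^ k)
  have h3 : (Φ ∘ fun w : EuclideanSpace ℝ (Fin n) × EuclideanSpace ℝ (Fin n) => (w.1, t • w.2))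
      =ᶠ[𝓝 z] fun w => t ^ k * Φ w := by
    filter_upwards [(isOpen_slit hU).mem_nhds hz] with w hw
    exact h w hw t ht
  have h4 := h1.unique (h2.congr_of_eventuallyEq h3)
  simpa using congrArg (fun A => A (u, v)) h4

theorem IsPosHomogeneous.pderivX {U : Set (EuclideanSpace ℝ (Fin n))} (hU : IsOpen U) {k : ℕ}
    {Φ : EuclideanSpace ℝ (Fin n) × EuclideanSpace ℝ (Fin n) → ℝ} (h : IsPosHomogeneous U k Φ)
    (hΦ : ContDiffOn ℝ ∞ Φ (slit U)) (i : Fin n) : IsPosHomogeneous U k (pderivX i Φ) := by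
  intro z hz t ht
  have := h.fderiv_scale hU hΦ hz ht (EuclideanSpace.single i 1) 0
  rwa [smul_zero] at this

theorem IsPosHomogeneous.pderivY {U : Set (EuclideanSpace ℝ (Fin n))} (hU : IsOpen U) {k : ℕ}
    {Φ : EuclideanSpace ℝ (Fin n) × EuclideanSpace ℝ (Fin n) → ℝ}
    (h : IsPosHomogeneous U (k + 1) Φ)
    (hΦ : ContDiffOn ℝ ∞ Φ (slit U)) (i : Fin n) : IsPosHomogeneous U k (pderivY i Φ) := by
  intro z hz t ht
  have := h.fderiv_scale hU hΦ hz ht 0 (EuclideanSpace.single i 1)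
  have h2 : ((0 : EuclideanSpace ℝ (Fin n)), t • EuclideanSpace.single i (1 : ℝ))
      = t • ((0 : EuclideanSpace ℝ (Fin n)), EuclideanSpace.single i (1 : ℝ)) := by simp
  rw [h2, map_smul, smul_eq_mul, pow_succ] at this
  unfold Finsler.pderivY
  have h3 : t ≠ 0 := ht.ne'
  apply mul_left_cancel₀ h3
  rw [this]; ring

/-- Euler's identity for functions that are homogeneous in `y`. -/
theorem IsPosHomogeneous.euler {U : Set (EuclideanSpace ℝ (Fin n))} (hU : IsOpen U) {k : ℕ}
    {Φ : EuclideanSpace ℝ (Fin n) × EuclideanSpace ℝ (Fin n) → ℝ}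
    (h : IsPosHomogeneous U k Φ) (hΦ : ContDiffOn ℝ ∞ Φ (slit U))
    {z : EuclideanSpace ℝ (Fin n) × EuclideanSpace ℝ (Fin n)} (hz : z ∈ slit U) :
    ∑ i, z.2 i * Finsler.pderivY i Φ z = k * Φ z := by
  have hd : DifferentiableAt ℝ Φ z :=
    (hΦ.contDiffAt ((isOpen_slit hU).mem_nhds hz)).differentiableAt (by simp)
  have hs : HasDerivAt (fun t : ℝ => (z.1, t • z.2)) (0, z.2) 1 := by
    simpa using (hasDerivAt_const (1 : ℝ) z.1).prodMk ((hasDerivAt_id (1 : ℝ)).smul_const z.2)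
  have hd' : HasFDerivAt Φ (fderiv ℝ Φ z) (z.1, (1 : ℝ) • z.2) := by
    simpa using hd.hasFDerivAt
  have h1 := hd'.comp_hasDerivAt (1 : ℝ) hs
  have h2 : HasDerivAt (fun t : ℝ => t ^ k * Φ z) (k * Φ z) 1 := by
    simpa using (hasDerivAt_pow k (1 : ℝ)).mul_const (Φ z)
  have h3 : (Φ ∘ fun t : ℝ => (z.1, t • z.2)) =ᶠ[𝓝 1] fun t => t ^ k * Φ z := by
    filter_upwards [lt_mem_nhds (zero_lt_one (α := ℝ))] with t ht
    exact h z hz t ht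
  have h4 := h1.unique (h2.congr_of_eventuallyEq h3)
  rw [fderiv_apply_eq_sum] at h4
  simpa using h4

/-- The coordinate expression of a Finsler structure over a domain `U`. -/
structure IsLocalFinsler (U : Set (EuclideanSpace ℝ (Fin n)))
    (F : EuclideanSpace ℝ (Fin n) × EuclideanSpace ℝ (Fin n) → ℝ) : Prop where
  isOpen : IsOpen U
  nonneg : ∀ z, 0 ≤ F z
  contDiffOn : ContDiffOn ℝ ∞ F (slit U)
  homogeneous : IsPosHomogeneous U 1 F
  posDef : ∀ z ∈ slit U, (fundamentalTensor F z).PosDef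

variable {U : Set (EuclideanSpace ℝ (Fin n))}
  {F : EuclideanSpace ℝ (Fin n) × EuclideanSpace ℝ (Fin n) → ℝ}

namespace IsLocalFinsler

theorem isOpen_slit (hF : IsLocalFinsler U F) : IsOpen (slit U) := Finsler.isOpen_slit hF.isOpen

theorem contDiffOn_sq (hF : IsLocalFinsler U F) : ContDiffOn ℝ ∞ (fun w => F w ^ 2) (slit U) :=
  hF.contDiffOn.pow 2

theorem contDiffOn_half_sq (hF : IsLocalFinsler U F) :
    ContDiffOn ℝ ∞ (fun w => 1 / 2 * F w ^ 2) (slit U) :=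
  contDiffOn_const.mul hF.contDiffOn_sq

theorem homogeneous_sq (hF : IsLocalFinsler U F) : IsPosHomogeneous U 2 (fun w => F w ^ 2) := by
  intro z hz t ht
  simp only [hF.homogeneous z hz t ht]
  ring

theorem homogeneous_half_sq (hF : IsLocalFinsler U F) :
    IsPosHomogeneous U 2 (fun w => 1 / 2 * F w ^ 2) := by
  intro z hz t ht
  simp only [hF.homogeneous z hz t ht]
  ring

theorem contDiffOn_fundamentalTensor (hF : IsLocalFinsler U F) (i j : Fin n) :
    ContDiffOn ℝ ∞ (fun z => fundamentalTensor F z i j) (slit U) :=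
  contDiffOn_pderivY hF.isOpen_slit (contDiffOn_pderivY hF.isOpen_slit hF.contDiffOn_half_sq i) j

theorem sum_fundamentalTensor_mul (hF : IsLocalFinsler U F)
    {z : EuclideanSpace ℝ (Fin n) × EuclideanSpace ℝ (Fin n)} (hz : z ∈ slit U) (i : Fin n) :
    ∑ j, z.2 j * fundamentalTensor F z i j = pderivY i (fun w => 1 / 2 * F w ^ 2) z := by
  have h := (hF.homogeneous_half_sq.pderivY hF.isOpen hF.contDiffOn_half_sq i).euler hF.isOpen
    (contDiffOn_pderivY hF.isOpen_slit hF.contDiffOn_half_sq i) hz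
  rwa [Nat.cast_one, one_mul] at h

theorem sum_sum_fundamentalTensor (hF : IsLocalFinsler U F)
    {z : EuclideanSpace ℝ (Fin n) × EuclideanSpace ℝ (Fin n)} (hz : z ∈ slit U) :
    ∑ i, ∑ j, fundamentalTensor F z i j * z.2 i * z.2 j = F z ^ 2 := by
  have h := hF.homogeneous_half_sq.euler hF.isOpen hF.contDiffOn_half_sq hz
  have h2 : F z ^ 2 = ((2 : ℕ) : ℝ) * (1 / 2 * F z ^ 2) := by push_cast; ring
  rw [h2, ← h]
  refine Finset.sum_congr rfl fun i _ => ?_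
  rw [← hF.sum_fundamentalTensor_mul hz i, Finset.mul_sum]
  exact Finset.sum_congr rfl fun j _ => by ring

/-- Euler's identity, applied twice, gives F² = g_{ij} yⁱ yʲ, which is positive by strong convexity.
-/
theorem pos (hF : IsLocalFinsler U F)
    {z : EuclideanSpace ℝ (Fin n) × EuclideanSpace ℝ (Fin n)} (hz : z ∈ slit U) : 0 < F z := by
  have h := (hF.posDef z hz).dotProduct_mulVec_pos (x := z.2.ofLp) (by
    simpa using hz.2)
  have h2 : star z.2.ofLp ⬝ᵥ (fundamentalTensor F z).mulVec z.2.ofLp = F z ^ 2 := by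
    rw [← hF.sum_sum_fundamentalTensor hz]
    simp only [dotProduct, Matrix.mulVec, Finset.mul_sum]
    refine Finset.sum_congr rfl fun i _ => Finset.sum_congr rfl fun j _ => ?_
    simp; ring
  rw [h2] at h
  exact lt_of_le_of_ne (hF.nonneg z) fun h0 => by rw [← h0] at h; simp at h

theorem contDiffOn_det {ι E : Type*} [NormedAddCommGroup E] [NormedSpace ℝ E] [Fintype ι]
    [DecidableEq ι] {A : E → Matrix ι ι ℝ} {S : Set E}
    (hA : ∀ i j, ContDiffOn ℝ ∞ (fun z => A z i j) S) : ContDiffOn ℝ ∞ (fun z => (A z).det) S := by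
  simp only [Matrix.det_apply]
  exact ContDiffOn.sum fun σ _ => (contDiffOn_prod fun i _ => hA _ _).const_smul _

/-- Cramer's rule: the entries of the inverse are quotients of determinants. -/
theorem contDiffOn_inv_apply {ι E : Type*} [NormedAddCommGroup E] [NormedSpace ℝ E] [Fintype ι]
    [DecidableEq ι] {A : E → Matrix ι ι ℝ} {S : Set E}
    (hA : ∀ i j, ContDiffOn ℝ ∞ (fun z => A z i j) S) (h0 : ∀ z ∈ S, (A z).det ≠ 0) (i j : ι) :
    ContDiffOn ℝ ∞ (fun z => (A z)⁻¹ i j) S := by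
  simp only [Matrix.inv_def, Matrix.smul_apply, Ring.inverse_eq_inv', smul_eq_mul,
    Matrix.adjugate_apply]
  refine ((contDiffOn_det hA).inv h0).mul (contDiffOn_det fun k l => ?_)
  simp only [Matrix.updateRow_apply]
  split_ifs
  · exact contDiffOn_const
  · exact hA k l

theorem det_ne_zero (hF : IsLocalFinsler U F)
    {z : EuclideanSpace ℝ (Fin n) × EuclideanSpace ℝ (Fin n)} (hz : z ∈ slit U) :
    (fundamentalTensor F z).det ≠ 0 := (hF.posDef z hz).det_pos.ne'

theorem contDiffOn_coord (S : Set (EuclideanSpace ℝ (Fin n) × EuclideanSpace ℝ (Fin n)))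
    (j : Fin n) : ContDiffOn ℝ ∞ (fun z => z.2 j) S := by
  have : ContDiff ℝ ∞ fun z : EuclideanSpace ℝ (Fin n) × EuclideanSpace ℝ (Fin n) => z.2 j := by
    fun_prop
  exact this.contDiffOn

theorem contDiffOn_spray (hF : IsLocalFinsler U F) (i : Fin n) :
    ContDiffOn ℝ ∞ (spray F i) (slit U) := by
  unfold spray
  refine contDiffOn_const.mul (ContDiffOn.sum fun l _ => ContDiffOn.mul ?_ (ContDiffOn.sub ?_ ?_))
  · exact contDiffOn_inv_apply hF.contDiffOn_fundamentalTensor (fun z hz => hF.det_ne_zero hz) i l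
  · exact ContDiffOn.sum fun k _ => (contDiffOn_pderivY hF.isOpen_slit
      (contDiffOn_pderivX hF.isOpen_slit hF.contDiffOn_sq k) l).mul (contDiffOn_coord _ k)
  · exact contDiffOn_pderivX hF.isOpen_slit hF.contDiffOn_sq l

theorem contDiffOn_riemannCurvature (hF : IsLocalFinsler U F) (i k : Fin n) :
    ContDiffOn ℝ ∞ (riemannCurvature F i k) (slit U) := by
  have hX : ∀ {Φ} (j : Fin n), ContDiffOn ℝ ∞ Φ (slit U) → ContDiffOn ℝ ∞ (pderivX j Φ) (slit U) :=
    fun j h => contDiffOn_pderivX hF.isOpen_slit h j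
  have hY : ∀ {Φ} (j : Fin n), ContDiffOn ℝ ∞ Φ (slit U) → ContDiffOn ℝ ∞ (pderivY j Φ) (slit U) :=
    fun j h => contDiffOn_pderivY hF.isOpen_slit h j
  have hG := hF.contDiffOn_spray
  unfold riemannCurvature
  refine contDiffOn_const.mul (ContDiffOn.add (ContDiffOn.sub (ContDiffOn.sub ?_ ?_) ?_) ?_)
  · exact contDiffOn_const.mul (hX _ (hG _))
  · exact contDiffOn_const.mul (ContDiffOn.sum fun j _ => (hY _ (hG _)).mul (hY _ (hG _)))
  · exact ContDiffOn.sum fun j _ => (contDiffOn_coord _ j).mul (hX _ (hY _ (hG _)))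
  · exact ContDiffOn.sum fun j _ => (hG _).mul (hY _ (hY _ (hG _)))

theorem contDiffOn_ricciTensor (hF : IsLocalFinsler U F) (i k : Fin n) :
    ContDiffOn ℝ ∞ (fun z => ricciTensor F z i k) (slit U) := by
  simp only [ricciTensor, Matrix.of_apply]
  exact contDiffOn_const.mul (contDiffOn_pderivY hF.isOpen_slit (contDiffOn_pderivY hF.isOpen_slit
    (ContDiffOn.sum fun j _ => hF.contDiffOn_riemannCurvature j j) i) k)

theorem pderivY_sq_eq (hF : IsLocalFinsler U F)
    {z : EuclideanSpace ℝ (Fin n) × EuclideanSpace ℝ (Fin n)} (hz : z ∈ slit U) (i : Fin n) :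
    pderivY i (fun w => F w ^ 2) z = 2 * ∑ j, z.2 j * fundamentalTensor F z i j := by
  rw [hF.sum_fundamentalTensor_mul hz]
  have hd : DifferentiableAt ℝ (fun w => F w ^ 2) z :=
    (hF.contDiffOn_sq.contDiffAt (hF.isOpen_slit.mem_nhds hz)).differentiableAt (by simp)
  unfold pderivY
  rw [fderiv_const_mul hd]
  simp

/-- The derivative of `F²` along the geodesic spray vanishes. -/
theorem fderiv_sq_spray (hF : IsLocalFinsler U F)
    {z : EuclideanSpace ℝ (Fin n) × EuclideanSpace ℝ (Fin n)} (hz : z ∈ slit U) :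
    fderiv ℝ (fun w => F w ^ 2) z (z.2, WithLp.toLp 2 fun i => -spray F i z) = 0 := by
  set L := fun w => F w ^ 2 with hL
  set g := fundamentalTensor F z with hg
  set b : Fin n → ℝ := fun l => (∑ k, pderivY l (pderivX k L) z * z.2 k) - pderivX l L z with hb
  have hsymm : ∀ i j, g i j = g j i := fun i j => by
    simpa using (hF.posDef z hz).1.apply j i
  have hG : ∀ i, spray F i z = 1 / 2 * (g⁻¹).mulVec b i := fun i => rfl
  -- Lowering the index of the spray removes the inverse matrix.
  have hinv : ∀ j, ∑ i, g j i * spray F i z = 1 / 2 * b j := by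
    intro j
    have h1 : g.mulVec ((g⁻¹).mulVec b) = b := by
      rw [Matrix.mulVec_mulVec, Matrix.mul_nonsing_inv _ (Ne.isUnit (hF.det_ne_zero hz)),
        Matrix.one_mulVec]
    have h2 := congrFun h1 j
    rw [← h2]
    simp only [hG, Matrix.mulVec, dotProduct, Finset.mul_sum]
    refine Finset.sum_congr rfl fun i _ => Finset.sum_congr rfl fun k _ => by ring
  have hX : ∀ k, ∑ l, z.2 l * pderivY l (pderivX k L) z = 2 * pderivX k L z := fun k => by
    simpa using (hF.homogeneous_sq.pderivX hF.isOpen hF.contDiffOn_sq k).euler hF.isOpen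
      (contDiffOn_pderivX hF.isOpen_slit hF.contDiffOn_sq k) hz
  -- Each [F²]_{xᵏ} has degree two in y, so by Euler the double sum equals 2 yᵏ [F²]_{xᵏ}, of which
  -- one copy is subtracted.
  have hyb : ∑ l, z.2 l * b l = ∑ l, z.2 l * pderivX l L z := by
    simp only [hb, mul_sub, Finset.sum_sub_distrib, Finset.mul_sum]
    rw [Finset.sum_comm]
    have : ∀ k, ∑ l, z.2 l * (pderivY l (pderivX k L) z * z.2 k) = 2 * (z.2 k * pderivX k L z) := by
      intro k
      calc _ = z.2 k * ∑ l, z.2 l * pderivY l (pderivX k L) z := by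
            rw [Finset.mul_sum]; exact Finset.sum_congr rfl fun l _ => by ring
        _ = _ := by rw [hX]; ring
    simp only [this, ← Finset.mul_sum]
    ring
  rw [fderiv_apply_eq_sum]
  have h1 : ∑ i, -spray F i z * pderivY i L z = -∑ l, z.2 l * b l := by
    simp only [hL, hF.pderivY_sq_eq hz, ← hg, Finset.mul_sum]
    rw [Finset.sum_comm, ← Finset.sum_neg_distrib]
    refine Finset.sum_congr rfl fun j _ => ?_
    calc _ = -(2 * z.2 j * ∑ i, g j i * spray F i z) := by
          rw [Finset.mul_sum, ← Finset.sum_neg_distrib]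
          exact Finset.sum_congr rfl fun i _ => by rw [hsymm i j]; ring
      _ = _ := by rw [hinv]; ring
  simp only [h1, hyb]
  ring

end IsLocalFinsler

end CoordinateCalculus

/-! ### Local flows and a shooting argument -/

section Flow

open Metric Set Filter
open scoped NNReal

variable {W E : Type*} [NormedAddCommGroup W] [NormedSpace ℝ W]
  [NormedAddCommGroup E] [NormedSpace ℝ E]

/-- A `C¹` vector field has a local flow, Lipschitz in the initial point, that stays in a
prescribed neighbourhood. -/
theorem exists_local_flow [CompleteSpace W] {f : W → W} {w₀ : W} (hf : ContDiffAt ℝ 1 f w₀) {S : Set W}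
    (hS : S ∈ 𝓝 w₀) : ∃ r > (0 : ℝ), ∃ ε > (0 : ℝ), ∃ L : ℝ≥0, ∃ α : W → ℝ → W,
      (∀ w ∈ closedBall w₀ r, α w 0 = w ∧
        ∀ t ∈ Ioo (-ε) ε, α w t ∈ S ∧ HasDerivAt (α w) (f (α w t)) t) ∧
      ∀ t ∈ Ioo (-ε) ε, LipschitzOnWith L (α · t) (closedBall w₀ r) := by
  obtain ⟨ε, hε, a, r, L, K, hr, hPL⟩ := IsPicardLindelof.of_contDiffAt_one hf
  obtain ⟨α, hα, L', hL'⟩ :=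
    (hPL 0).exists_forall_mem_closedBall_eq_hasDerivWithinAt_lipschitzOnWith
  obtain ⟨δ, hδ, hδS⟩ := Metric.mem_nhds_iff.1 hS
  have hw0 : w₀ ∈ closedBall w₀ (r : ℝ) := mem_closedBall_self r.2
  have h0 : (0 : ℝ) ∈ Icc (0 - ε) (0 + ε) := ⟨by linarith, by linarith⟩
  have hcont : ContinuousAt (α w₀) 0 :=
    (((hα w₀ hw0).2 0 h0).hasDerivAt (Icc_mem_nhds (by linarith) (by linarith))).continuousAt
  obtain ⟨ε', hε', hclose⟩ := Metric.continuousAt_iff.1 hcont (δ / 2) (by positivity)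
  have hα0 : α w₀ 0 = w₀ := (hα w₀ hw0).1
  -- Half of δ is spent on the change of initial point, half on the motion of the central curve; L'
  -- + 1 avoids a zero denominator.
  refine ⟨min r (δ / (2 * (L' + 1))), lt_min hr (by positivity), min ε ε', lt_min hε hε', L', α,
    fun w hw => ?_, fun t ht => ?_⟩
  · have hwr : w ∈ closedBall w₀ (r : ℝ) := closedBall_subset_closedBall (min_le_left _ _) hw
    refine ⟨(hα w hwr).1, fun t ht => ?_⟩
    have htε : |t| < min ε ε' := abs_lt.2 ⟨ht.1, ht.2⟩
    have htε1 := abs_lt.1 (htε.trans_le (min_le_left _ _))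
    have htI : t ∈ Icc (0 - ε) (0 + ε) := ⟨by linarith, by linarith⟩
    refine ⟨hδS ?_, ((hα w hwr).2 t htI).hasDerivAt (Icc_mem_nhds (by linarith) (by linarith))⟩
    have h1 : dist (α w t) (α w₀ t) ≤ L' * dist w w₀ := (hL' t htI).dist_le_mul _ hwr _ hw0
    have h2 : dist (α w₀ t) w₀ < δ / 2 := by
      have := @hclose t (by simpa using htε.trans_le (min_le_right _ _))
      rwa [hα0] at this
    have h3 : dist w w₀ ≤ δ / (2 * (L' + 1)) := (mem_closedBall.1 hw).trans (min_le_right _ _)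
    have h4 : (L' : ℝ) * dist w w₀ ≤ δ / 2 := by
      calc (L' : ℝ) * dist w w₀ ≤ (L' + 1) * (δ / (2 * (L' + 1))) := by
            gcongr; linarith
        _ = δ / 2 := by field_simp
    rw [mem_ball]
    linarith [dist_triangle (α w t) (α w₀ t) w₀]
  · have htε : |t| < min ε ε' := abs_lt.2 ⟨ht.1, ht.2⟩
    have htε1 := abs_lt.1 (htε.trans_le (min_le_left _ _))
    exact (hL' t ⟨by linarith, by linarith⟩).mono (closedBall_subset_closedBall (min_le_left _ _))

/-- A second order mean value estimate. -/
theorem norm_sub_sub_smul_le {P D K : ℝ → E} {T C : ℝ} (hT : 0 ≤ T)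
    (hP : ∀ t ∈ Icc 0 T, HasDerivAt P (D t) t) (hD : ∀ t ∈ Icc 0 T, HasDerivAt D (K t) t)
    (hK : ∀ t ∈ Icc 0 T, ‖K t‖ ≤ C) : ‖P T - P 0 - T • D 0‖ ≤ C * T ^ 2 := by
  have hC : 0 ≤ C := (norm_nonneg _).trans (hK 0 ⟨le_rfl, hT⟩)
  have h1 : ∀ t ∈ Icc 0 T, ‖D t - D 0‖ ≤ C * T := fun t ht =>
    (norm_image_sub_le_of_norm_deriv_le_segment' (fun s hs => (hD s hs).hasDerivWithinAt)
      (fun s hs => hK s ⟨hs.1, hs.2.le⟩) t ht).trans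
      (mul_le_mul_of_nonneg_left (by linarith [ht.2]) hC)
  have h2 : ∀ t ∈ Icc 0 T, HasDerivAt (fun t => P t - t • D 0) (D t - D 0) t := fun t ht => by
    simpa using (hP t ht).fun_sub ((hasDerivAt_id t).smul_const (D 0))
  have h3 := norm_image_sub_le_of_norm_deriv_le_segment' (fun s hs => (h2 s hs).hasDerivWithinAt)
    (fun s hs => h1 s ⟨hs.1, hs.2.le⟩) T ⟨hT, le_rfl⟩
  calc ‖P T - P 0 - T • D 0‖ = ‖(P T - T • D 0) - (P 0 - (0 : ℝ) • D 0)‖ := by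
        congr 1; simp only [zero_smul, sub_zero]; abel
    _ ≤ C * T * (T - 0) := h3
    _ = C * T ^ 2 := by ring

/-- Shooting: if the velocity of `π ∘ α` can be prescribed freely for the integral curves `α` of a
smooth vector field, then all points near `x₀` are reached from one and the same point. -/
theorem exists_shooting [CompleteSpace W] [CompleteSpace E] {f : W → W} {w₀ : W} {S : Set W} (hf : ContDiffAt ℝ 2 f w₀)
    (hS : S ∈ 𝓝 w₀) (π : W →L[ℝ] E) {x₀ y₀ : E} {ι : E × E → W}
    (hι : ContDiffAt ℝ 1 ι (x₀, y₀)) (hι₀ : ι (x₀, y₀) = w₀) {N : Set (E × E)}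
    (hN : N ∈ 𝓝 (x₀, y₀)) (hx : ∀ z ∈ N, π (ι z) = z.1) (hv : ∀ z ∈ N, π (f (ι z)) = z.2) :
    ∃ T > (0 : ℝ), ∃ ε > T, ∃ x₁ : E, ∀ᶠ x' in 𝓝 x₀, ∃ (v : E) (α : ℝ → W),
      (x₁, v) ∈ N ∧ α 0 = ι (x₁, v) ∧
      (∀ t ∈ Ioo (-ε) ε, α t ∈ S ∧ HasDerivAt α (f (α t)) t) ∧ π (α T) = x' := by
  set h : W → E := fun w => π (f w) with hh
  -- Along an integral curve α, `h` and `k` are the first and second derivatives of π ∘ α.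
  set k : W → E := fun w => π (fderiv ℝ f w (f w)) with hk
  have hf1 : ContDiffAt ℝ 1 f w₀ := hf.of_le (by norm_num)
  have hkC : ContDiffAt ℝ 1 k w₀ :=
    π.contDiff.contDiffAt.comp w₀ ((hf.fderiv_right (m := 1) (by norm_num)).clm_apply hf1)
  obtain ⟨K, s, hs, hKs⟩ := hkC.exists_lipschitzOnWith
  have hbound : ∀ᶠ w in 𝓝 w₀, ‖k w‖ < ‖k w₀‖ + 1 :=
    hkC.continuousAt.norm.eventually_lt continuousAt_const (by linarith)
  have hdiff : ∀ᶠ w in 𝓝 w₀, DifferentiableAt ℝ f w := by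
    filter_upwards [hf1.eventually (by simp)] with w hw using hw.differentiableAt (by simp)
  obtain ⟨r, hr, ε, hε, L, α, hα, hL⟩ :=
    exists_local_flow hf1 (inter_mem (inter_mem hS hs) (hbound.and hdiff))
  have hαh : ∀ w ∈ closedBall w₀ r, ∀ t ∈ Ioo (-ε) ε,
      HasDerivAt (fun t => π (α w t)) (h (α w t)) t ∧
      HasDerivAt (fun t => h (α w t)) (k (α w t)) t := by
    intro w hw t ht
    have hd := ((hα w hw).2 t ht).2
    have hfd := ((hα w hw).2 t ht).1.2.2.hasFDerivAt
    exact ⟨π.hasFDerivAt.comp_hasDerivAt t hd,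
      π.hasFDerivAt.comp_hasDerivAt t (hfd.comp_hasDerivAt t hd)⟩
  obtain ⟨Kι, sι, hsι, hKι⟩ := hι.exists_lipschitzOnWith
  have hιball : ι ⁻¹' closedBall w₀ r ∈ 𝓝 (x₀, y₀) :=
    hι.continuousAt.preimage_mem_nhds (by rw [hι₀]; exact closedBall_mem_nhds _ hr)
  obtain ⟨ρ, hρ, hρN⟩ := Metric.nhds_basis_closedBall.mem_iff.1
    (inter_mem (inter_mem hN hsι) hιball)
  set C : ℝ := K * L with hC
  set B : ℝ := ‖k w₀‖ + 1 with hB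
  -- The conditions on T: the flow lasts beyond T, the starting point stays within ρ of x₀, the
  -- nonlinear part of the end point map is less than half the linear part, and the central curve
  -- ends close to x₀.
  have hT : ∀ᶠ T in 𝓝[>] (0 : ℝ), 0 < T ∧ T < ε ∧ T * ‖y₀‖ < ρ ∧ C * Kι * T < 1 / 2 ∧
      B * T < ρ / 4 := by
    have hlim : ∀ c d : ℝ, 0 < d → ∀ᶠ T in 𝓝[>] (0 : ℝ), c * T < d := fun c d hd => by
      have : Tendsto (fun T : ℝ => c * T) (𝓝[>] 0) (𝓝 (c * 0)) :=
        ((continuous_const.mul continuous_id).tendsto 0).mono_left nhdsWithin_le_nhds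
      exact this.eventually_lt_const (by simpa using hd)
    filter_upwards [self_mem_nhdsWithin, hlim 1 ε hε, hlim ‖y₀‖ ρ hρ, hlim (C * Kι) (1 / 2)
      (by norm_num), hlim B (ρ / 4) (by positivity)] with T h1 h2 h3 h4 h5
    exact ⟨h1, by simpa using h2, by rwa [mul_comm], h4, h5⟩
  obtain ⟨T, hT0, hTε, hTρ, hTC, hTB⟩ := hT.exists
  set x₁ : E := x₀ - T • y₀ with hx1
  have hmem : ∀ v ∈ closedBall y₀ ρ, (x₁, v) ∈ closedBall (x₀, y₀) ρ := by
    intro v hv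
    rw [mem_closedBall, Prod.dist_eq, max_le_iff]
    refine ⟨?_, mem_closedBall.1 hv⟩
    simp only [hx1, dist_eq_norm, sub_sub_cancel_left, norm_neg, norm_smul, Real.norm_eq_abs,
      abs_of_pos hT0]
    exact hTρ.le
  have hTI : ∀ t ∈ Icc 0 T, t ∈ Ioo (-ε) ε := fun t ht => ⟨by linarith [ht.1], by linarith [ht.2]⟩
  set Φ : E → E := fun v => π (α (ι (x₁, v)) T) with hΦ
  have happrox : ApproximatesLinearOn Φ (T • ContinuousLinearMap.id ℝ E) (closedBall y₀ ρ)
      (Real.toNNReal (C * Kι * T ^ 2)) := by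
    intro v hv' v' hv''
    obtain ⟨⟨hN1, hs1⟩, hb1⟩ := hρN (hmem v hv')
    obtain ⟨⟨hN2, hs2⟩, hb2⟩ := hρN (hmem v' hv'')
    have hest := norm_sub_sub_smul_le (P := fun t => π (α (ι (x₁, v)) t) - π (α (ι (x₁, v')) t))
      (D := fun t => h (α (ι (x₁, v)) t) - h (α (ι (x₁, v')) t))
      (K := fun t => k (α (ι (x₁, v)) t) - k (α (ι (x₁, v')) t))
      (C := C * (Kι * ‖v - v'‖)) hT0.le
      (fun t ht => (hαh _ hb1 t (hTI t ht)).1.fun_sub (hαh _ hb2 t (hTI t ht)).1)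
      (fun t ht => (hαh _ hb1 t (hTI t ht)).2.fun_sub (hαh _ hb2 t (hTI t ht)).2)
      (fun t ht => by
        have e1 := hKs.dist_le_mul _ ((hα _ hb1).2 t (hTI t ht)).1.1.2 _
          ((hα _ hb2).2 t (hTI t ht)).1.1.2
        have e2 := (hL t (hTI t ht)).dist_le_mul _ hb1 _ hb2
        have e3 := hKι.dist_le_mul _ hs1 _ hs2
        have e4 : dist (x₁, v) (x₁, v') = ‖v - v'‖ := by
          rw [Prod.dist_eq, dist_self, max_eq_right dist_nonneg, dist_eq_norm]
        rw [e4] at e3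
        rw [← dist_eq_norm]
        calc _ ≤ _ := e1
          _ ≤ K * (L * (Kι * ‖v - v'‖)) := by gcongr; exact e2.trans (by gcongr)
          _ = _ := by rw [hC]; ring)
    -- Both curves start at x₁, so the zeroth order terms cancel and the first order term is T(v -
    -- v').
    have i1 : α (ι (x₁, v)) 0 = ι (x₁, v) := (hα _ hb1).1
    have i2 : α (ι (x₁, v')) 0 = ι (x₁, v') := (hα _ hb2).1
    have j1 : h (ι (x₁, v)) = v := hv _ hN1
    have j2 : h (ι (x₁, v')) = v' := hv _ hN2
    simp only [i1, i2, hx _ hN1, hx _ hN2, sub_self, sub_zero, j1, j2] at hest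
    rw [Real.coe_toNNReal _ (by positivity)]
    calc _ ≤ _ := hest
      _ = _ := by ring
  obtain ⟨R, hR⟩ : ∃ R : (T • ContinuousLinearMap.id ℝ E).NonlinearRightInverse,
      R.nnnorm = Real.toNNReal T⁻¹ :=
    ⟨{ toFun := fun y => T⁻¹ • y
       nnnorm := Real.toNNReal T⁻¹
       bound' := fun y => by
        rw [Real.coe_toNNReal _ (by positivity), norm_smul, Real.norm_eq_abs,
          abs_of_pos (by positivity)]
       right_inv' := fun y => by simp [smul_smul, hT0.ne'] }, rfl⟩
  have hsurj := happrox.surjOn_closedBall_of_nonlinearRightInverse R hρ.le subset_rfl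
  rw [hR, Real.coe_toNNReal _ (by positivity), Real.coe_toNNReal _ (by positivity), inv_inv] at hsurj
  have hy : y₀ ∈ closedBall y₀ ρ := mem_closedBall_self hρ.le
  obtain ⟨⟨hN0, hs0⟩, hb0⟩ := hρN (hmem y₀ hy)
  have hcenter : dist (Φ y₀) x₀ ≤ B * T ^ 2 := by
    have hest := norm_sub_sub_smul_le (P := fun t => π (α (ι (x₁, y₀)) t))
      (D := fun t => h (α (ι (x₁, y₀)) t)) (K := fun t => k (α (ι (x₁, y₀)) t)) (C := B) hT0.le
      (fun t ht => (hαh _ hb0 t (hTI t ht)).1) (fun t ht => (hαh _ hb0 t (hTI t ht)).2)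
      (fun t ht => ((hα _ hb0).2 t (hTI t ht)).1.2.1.le)
    have i1 : α (ι (x₁, y₀)) 0 = ι (x₁, y₀) := (hα _ hb0).1
    have j1 : h (ι (x₁, y₀)) = y₀ := hv _ hN0
    simp only [i1, hx _ hN0, j1] at hest
    rw [dist_eq_norm]
    have : Φ y₀ - x₀ = π (α (ι (x₁, y₀)) T) - x₁ - T • y₀ := by
      rw [sub_sub, hx1, sub_add_cancel]
    rwa [this]
  refine ⟨T, hT0, ε, hTε, x₁, ?_⟩
  filter_upwards [closedBall_mem_nhds x₀ (show 0 < T * ρ / 4 by positivity)] with x' hx'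
  -- The image contains the ball of radius (T - C Kι T²)ρ ≥ Tρ/2 about Φ(y₀), and Φ(y₀) is within
  -- Tρ/4 of x₀; this leaves the ball of radius Tρ/4 about x₀.
  have hx'' : x' ∈ closedBall (Φ y₀) ((T - C * Kι * T ^ 2) * ρ) := by
    rw [mem_closedBall] at hx' ⊢
    have e1 := dist_triangle_right x' (Φ y₀) x₀
    have e2 : B * T ^ 2 ≤ T * ρ / 4 := by nlinarith
    have e3 : C * Kι * T ^ 2 ≤ T / 2 := by nlinarith
    nlinarith
  obtain ⟨v, hv', hvx⟩ := hsurj hx''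
  obtain ⟨⟨hN1, hs1⟩, hb1⟩ := hρN (hmem v hv')
  exact ⟨v, α (ι (x₁, v)), hN1, (hα _ hb1).1,
    fun t ht => ⟨((hα _ hb1).2 t ht).1.1.1, ((hα _ hb1).2 t ht).2⟩, hvx⟩

/-- Integral curves of smooth vector fields are smooth. -/
theorem contDiffOn_of_hasDerivAt {f : W → W} {S : Set W} (hf : ContDiffOn ℝ ∞ f S)
    {α : ℝ → W} {J : Set ℝ} (hJ : IsOpen J) (hmem : ∀ t ∈ J, α t ∈ S)
    (hα : ∀ t ∈ J, HasDerivAt α (f (α t)) t) : ContDiffOn ℝ ∞ α J := by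
  rw [contDiffOn_infty]
  intro m
  induction m with
  | zero =>
    exact contDiffOn_zero.2 fun t ht => (hα t ht).continuousAt.continuousWithinAt
  | succ m ih =>
    push_cast
    rw [contDiffOn_succ_iff_deriv_of_isOpen hJ]
    refine ⟨fun t ht => (hα t ht).differentiableAt.differentiableWithinAt, by simp, ?_⟩
    exact ((hf.of_le (by exact_mod_cast le_top)).comp ih hmem).congr fun t ht => (hα t ht).deriv

end Flow

/-! ### Geodesic arcs with projective parameter in coordinates -/

section LocalArcs

open Set Filter

variable {n : ℕ} {U : Set (EuclideanSpace ℝ (Fin n))}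
  {F : EuclideanSpace ℝ (Fin n) × EuclideanSpace ℝ (Fin n) → ℝ}

/-- The right hand side `2/(n-1) Ric_{jk} yʲ yᵏ` of the equation of projective parameters. -/
def projectiveRHS (F : EuclideanSpace ℝ (Fin n) × EuclideanSpace ℝ (Fin n) → ℝ)
    (z : EuclideanSpace ℝ (Fin n) × EuclideanSpace ℝ (Fin n)) : ℝ :=
  2 / ((n : ℝ) - 1) * ∑ j, ∑ k, ricciTensor F z j k * z.2 j * z.2 k

theorem IsLocalFinsler.contDiffOn_projectiveRHS (hF : IsLocalFinsler U F) :
    ContDiffOn ℝ ∞ (projectiveRHS F) (slit U) :=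
  contDiffOn_const.mul (ContDiffOn.sum fun j _ => ContDiffOn.sum fun k _ =>
    ((hF.contDiffOn_ricciTensor j k).mul (IsLocalFinsler.contDiffOn_coord _ j)).mul
      (IsLocalFinsler.contDiffOn_coord _ k))

/-- The vector of spray coefficients. -/
def sprayVector (F : EuclideanSpace ℝ (Fin n) × EuclideanSpace ℝ (Fin n) → ℝ)
    (z : EuclideanSpace ℝ (Fin n) × EuclideanSpace ℝ (Fin n)) : EuclideanSpace ℝ (Fin n) :=
  WithLp.toLp 2 fun i => -spray F i z

theorem IsLocalFinsler.contDiffOn_sprayVector (hF : IsLocalFinsler U F) :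
    ContDiffOn ℝ ∞ (sprayVector F) (slit U) :=
  contDiffOn_euclidean.2 fun i => (hF.contDiffOn_spray i).neg

/-- A unit speed geodesic `X`, in coordinates, with a projective parameter `p` that maps its
interval of definition `J` onto `(-1, 1)`. -/
structure IsCoordProjectiveArc (U : Set (EuclideanSpace ℝ (Fin n)))
    (F : EuclideanSpace ℝ (Fin n) × EuclideanSpace ℝ (Fin n) → ℝ) (J : Set ℝ)
    (X : ℝ → EuclideanSpace ℝ (Fin n)) (p : ℝ → ℝ) : Prop where
  isOpen : IsOpen J
  ordConnected : J.OrdConnected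
  contDiffOn : ContDiffOn ℝ ∞ X J
  mem : ∀ s ∈ J, X s ∈ U
  unit_speed : ∀ s ∈ J, F (X s, deriv X s) = 1
  geodesic : ∀ s ∈ J, ∀ i, deriv (deriv X) s i + spray F i (X s, deriv X s) = 0
  contDiffOn_param : ContDiffOn ℝ ∞ p J
  deriv_ne_zero : ∀ s ∈ J, deriv p s ≠ 0
  schwarzian_eq : ∀ s ∈ J, schwarzian p s = projectiveRHS F (X s, deriv X s)
  bijOn : BijOn p J (Ioo (-1) 1)

/-- The affine map sends p(a), p(b) to -1, 1. Continuity up to the closed interval is what makes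
these end values finite and the image all of (-1, 1). -/
theorem bijOn_Ioo_of_strictMonoOn {p : ℝ → ℝ} {a b : ℝ} (hab : a < b)
    (hc : ContinuousOn p (Icc a b)) (hm : StrictMonoOn p (Icc a b)) :
    BijOn (fun s => 2 / (p b - p a) * p s + -(p a + p b) / (p b - p a)) (Ioo a b)
      (Ioo (-1) 1) := by
  have ha : a ∈ Icc a b := left_mem_Icc.2 hab.le
  have hb : b ∈ Icc a b := right_mem_Icc.2 hab.le
  have hpos : 0 < p b - p a := sub_pos.2 (hm ha hb hab)
  have hform : ∀ s, 2 / (p b - p a) * p s + -(p a + p b) / (p b - p a)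
      = (2 * p s - (p a + p b)) / (p b - p a) := fun s => by ring
  simp only [hform]
  refine ⟨fun s hs => ?_, fun s hs t ht hst => ?_, fun u hu => ?_⟩
  · have h1 := hm ha (Ioo_subset_Icc_self hs) hs.1
    have h2 := hm (Ioo_subset_Icc_self hs) hb hs.2
    rw [mem_Ioo, lt_div_iff₀ hpos, div_lt_iff₀ hpos]
    constructor <;> linarith
  · refine hm.injOn (Ioo_subset_Icc_self hs) (Ioo_subset_Icc_self ht) ?_
    have : 2 * p s - (p a + p b) = 2 * p t - (p a + p b) := by
      simpa [div_left_inj' hpos.ne'] using hst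
    linarith
  · have hu' : (u * (p b - p a) + (p a + p b)) / 2 ∈ Ioo (p a) (p b) := by
      constructor <;> nlinarith [hu.1, hu.2]
    obtain ⟨s, hs, hsu⟩ := intermediate_value_Ioo hab.le hc hu'
    refine ⟨s, hs, ?_⟩
    simp only [hsu]
    field_simp
    ring

theorem deriv_eqOn {E : Type*} [NormedAddCommGroup E] [NormedSpace ℝ E] {f f' f'' : ℝ → E}
    {J : Set ℝ} (hJ : IsOpen J) (h : ∀ s ∈ J, HasDerivAt f (f' s) s)
    (h' : ∀ s ∈ J, HasDerivAt f' (f'' s) s) : ∀ s ∈ J, HasDerivAt (deriv f) (f'' s) s :=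
  fun s hs => (h' s hs).congr_of_eventuallyEq <| by
    filter_upwards [hJ.mem_nhds hs] with t ht using (h t ht).deriv

/-- A solution of the geodesic equation together with a solution `a = p''/p'` of the Riccati
equation for projective parameters gives a projective arc. -/
theorem isCoordProjectiveArc_of_hasDerivAt (hF : IsLocalFinsler U F) {η δ : ℝ} (hδ : 0 < δ)
    (hδη : δ < η) {X Y : ℝ → EuclideanSpace ℝ (Fin n)} {a b p : ℝ → ℝ}
    (hmem : ∀ s ∈ Ioo (-η) η, (X s, Y s) ∈ slit U) (hbpos : ∀ s ∈ Ioo (-η) η, 0 < b s)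
    (hX : ∀ s ∈ Ioo (-η) η, HasDerivAt X (Y s) s)
    (hY : ∀ s ∈ Ioo (-η) η, HasDerivAt Y (sprayVector F (X s, Y s)) s)
    (ha : ∀ s ∈ Ioo (-η) η, HasDerivAt a (projectiveRHS F (X s, Y s) + a s ^ 2 / 2) s)
    (hb : ∀ s ∈ Ioo (-η) η, HasDerivAt b (a s * b s) s)
    (hp : ∀ s ∈ Ioo (-η) η, HasDerivAt p (b s) s)
    (hXs : ContDiffOn ℝ ∞ X (Ioo (-η) η)) (hps : ContDiffOn ℝ ∞ p (Ioo (-η) η))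
    (h1 : F (X 0, Y 0) = 1) :
    ∃ P : ℝ → ℝ, IsCoordProjectiveArc U F (Ioo (-δ) δ) X P := by
  have hη : 0 < η := hδ.trans hδη
  have hsub : Ioo (-δ) δ ⊆ Ioo (-η) η := Ioo_subset_Ioo (by linarith) hδη.le
  have hsub' : Icc (-δ) δ ⊆ Ioo (-η) η := Icc_subset_Ioo (by linarith) hδη
  have hpc : ContinuousOn p (Icc (-δ) δ) := fun s hs =>
    (hp s (hsub' hs)).continuousAt.continuousWithinAt
  have hpm : StrictMonoOn p (Icc (-δ) δ) := by
    refine strictMonoOn_of_deriv_pos (convex_Icc _ _) hpc fun s hs => ?_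
    rw [interior_Icc] at hs
    rw [(hp s (hsub hs)).deriv]
    exact hbpos s (hsub hs)
  -- F² is constant along the spray by `fderiv_sq_spray`, and F ≥ 0 fixes the sign of the root.
  have hunit : ∀ s ∈ Ioo (-η) η, F (X s, Y s) = 1 := by
    have hd : ∀ s ∈ Ioo (-η) η, HasDerivAt (fun s => F (X s, Y s) ^ 2) 0 s := by
      intro s hs
      have hdiff : DifferentiableAt ℝ (fun w => F w ^ 2) (X s, Y s) :=
        (hF.contDiffOn_sq.contDiffAt (hF.isOpen_slit.mem_nhds (hmem s hs))).differentiableAt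
          (by simp)
      have h2 := hdiff.hasFDerivAt.comp_hasDerivAt s ((hX s hs).prodMk (hY s hs))
      have h3 := hF.fderiv_sq_spray (hmem s hs)
      simp only [sprayVector] at h2
      rwa [h3] at h2
    intro s hs
    have h0 : (0 : ℝ) ∈ Ioo (-η) η := ⟨by linarith, hη⟩
    have h2 := isOpen_Ioo.is_const_of_deriv_eq_zero isPreconnected_Ioo
      (fun s hs => (hd s hs).differentiableAt.differentiableWithinAt)
      (fun s hs => (hd s hs).deriv) hs h0
    simp only [h1, one_pow] at h2
    exact (pow_eq_one_iff_of_nonneg (hF.nonneg _) two_ne_zero).1 h2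
  set c : ℝ := 2 / (p δ - p (-δ)) with hc
  set d : ℝ := -(p (-δ) + p δ) / (p δ - p (-δ)) with hd
  have hcpos : 0 < c := by
    have := hpm ⟨le_rfl, by linarith⟩ ⟨by linarith, le_rfl⟩ (show -δ < δ by linarith)
    have : 0 < p δ - p (-δ) := by linarith
    positivity
  set P : ℝ → ℝ := fun s => c * p s + d with hP
  have hP1 : ∀ s ∈ Ioo (-δ) δ, HasDerivAt P (c * b s) s := fun s hs =>
    ((hp s (hsub hs)).const_mul c).add_const d
  have hP2 : ∀ s ∈ Ioo (-δ) δ, HasDerivAt (deriv P) (c * (a s * b s)) s :=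
    deriv_eqOn isOpen_Ioo hP1 fun s hs => (hb s (hsub hs)).const_mul c
  have hP3 : ∀ s ∈ Ioo (-δ) δ, HasDerivAt (deriv (deriv P))
      (c * ((projectiveRHS F (X s, Y s) + a s ^ 2 / 2) * b s + a s * (a s * b s))) s :=
    deriv_eqOn isOpen_Ioo hP2 fun s hs =>
      ((ha s (hsub hs)).mul (hb s (hsub hs))).const_mul c
  have hX1 : ∀ s ∈ Ioo (-δ) δ, deriv X s = Y s := fun s hs => (hX s (hsub hs)).deriv
  have hX2 : ∀ s ∈ Ioo (-δ) δ, deriv (deriv X) s = sprayVector F (X s, Y s) := fun s hs =>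
    (deriv_eqOn isOpen_Ioo (fun s hs => hX s (hsub hs)) (fun s hs => hY s (hsub hs)) s hs).deriv
  refine ⟨P, ?_⟩
  constructor
  · exact isOpen_Ioo
  · exact ordConnected_Ioo
  · exact hXs.mono hsub
  · exact fun s hs => (hmem s (hsub hs)).1
  · exact fun s hs => by rw [hX1 s hs]; exact hunit s (hsub hs)
  · intro s hs i
    rw [hX1 s hs, hX2 s hs]
    simp [sprayVector]
  · exact (contDiffOn_const.mul (hps.mono hsub)).add contDiffOn_const
  · intro s hs
    rw [(hP1 s hs).deriv]
    exact (mul_pos hcpos (hbpos s (hsub hs))).ne'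
  · intro s hs
    have hb0 := (hbpos s (hsub hs)).ne'
    have hc0 := hcpos.ne'
    -- Here P''/P' = a and P'''/P' = Q + 3a²/2 by the Riccati equation, so the Schwarzian is Q.
    rw [schwarzian, (hP1 s hs).deriv, (hP2 s hs).deriv, (hP3 s hs).deriv, hX1 s hs]
    field_simp
    ring
  · exact bijOn_Ioo_of_strictMonoOn (by linarith) hpc hpm

/-- The state space of the system for geodesics with projective parameter: position, direction,
speed, `p''/p'`, `p'` and `p`. -/
abbrev ArcState (n : ℕ) : Type :=
  EuclideanSpace ℝ (Fin n) × EuclideanSpace ℝ (Fin n) × ℝ × ℝ × ℝ × ℝ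

/-- The vector field that governs geodesics with projective parameter. -/
def arcField (F : EuclideanSpace ℝ (Fin n) × EuclideanSpace ℝ (Fin n) → ℝ) (w : ArcState n) :
    ArcState n :=
  (w.2.2.1 • w.2.1, w.2.2.1 • sprayVector F (w.1, w.2.1), 0,
    w.2.2.1 * (projectiveRHS F (w.1, w.2.1) + w.2.2.2.1 ^ 2 / 2),
    w.2.2.1 * (w.2.2.2.1 * w.2.2.2.2.1), w.2.2.1 * w.2.2.2.2.1)

/-- The states with position in `U`, nonzero direction, and `p' > 0`. -/
def arcDomain (U : Set (EuclideanSpace ℝ (Fin n))) : Set (ArcState n) :=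
  {w | (w.1, w.2.1) ∈ slit U ∧ 0 < w.2.2.2.2.1}

theorem isOpen_arcDomain (hU : IsOpen U) : IsOpen (arcDomain U) :=
  ((isOpen_slit hU).preimage (by fun_prop : Continuous fun w : ArcState n => (w.1, w.2.1))).inter
    (isOpen_lt continuous_const (by fun_prop : Continuous fun w : ArcState n => w.2.2.2.2.1))

theorem IsLocalFinsler.contDiffOn_arcField (hF : IsLocalFinsler U F) :
    ContDiffOn ℝ ∞ (arcField F) (arcDomain U) := by
  have hz : ContDiffOn ℝ ∞ (fun w : ArcState n => (w.1, w.2.1)) (arcDomain U) :=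
    (by fun_prop : ContDiff ℝ ∞ fun w : ArcState n => (w.1, w.2.1)).contDiffOn
  have hmaps : MapsTo (fun w : ArcState n => (w.1, w.2.1)) (arcDomain U) (slit U) :=
    fun w hw => hw.1
  have hG := hF.contDiffOn_sprayVector.comp hz hmaps
  have hQ := hF.contDiffOn_projectiveRHS.comp hz hmaps
  have hl : ContDiffOn ℝ ∞ (fun w : ArcState n => w.2.2.1) (arcDomain U) :=
    (by fun_prop : ContDiff ℝ ∞ fun w : ArcState n => w.2.2.1).contDiffOn
  have ha : ContDiffOn ℝ ∞ (fun w : ArcState n => w.2.2.2.1 ^ 2 / 2) (arcDomain U) :=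
    (by fun_prop : ContDiff ℝ ∞ fun w : ArcState n => w.2.2.2.1 ^ 2 / 2).contDiffOn
  refine ContDiffOn.prodMk ?_ (ContDiffOn.prodMk ?_ (ContDiffOn.prodMk contDiffOn_const
    (ContDiffOn.prodMk ?_ (ContDiffOn.prodMk ?_ ?_))))
  · exact (by fun_prop : ContDiff ℝ ∞ fun w : ArcState n => w.2.2.1 • w.2.1).contDiffOn
  · exact hl.smul hG
  · exact hl.mul (hQ.add ha)
  · exact (by fun_prop : ContDiff ℝ ∞
      fun w : ArcState n => w.2.2.1 * (w.2.2.2.1 * w.2.2.2.2.1)).contDiffOn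
  · exact (by fun_prop : ContDiff ℝ ∞
      fun w : ArcState n => w.2.2.1 * w.2.2.2.2.1).contDiffOn

/-- The initial state of the geodesic from `z.1` with initial velocity `z.2`. -/
def arcInit (F : EuclideanSpace ℝ (Fin n) × EuclideanSpace ℝ (Fin n) → ℝ)
    (z : EuclideanSpace ℝ (Fin n) × EuclideanSpace ℝ (Fin n)) : ArcState n :=
  -- The direction is normalized and the speed is a separate constant of motion, so the initial
  -- velocity of the position is exactly z.2, as shooting requires. The values 0, 1, 0 of p''/p',
  -- p', p are a free choice with p' > 0.
  (z.1, (F z)⁻¹ • z.2, F z, 0, 1, 0)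

theorem hasDerivAt_fst {E E' : Type*} [NormedAddCommGroup E] [NormedSpace ℝ E]
    [NormedAddCommGroup E'] [NormedSpace ℝ E'] {f : ℝ → E × E'} {f' : E × E'} {s : ℝ}
    (h : HasDerivAt f f' s) : HasDerivAt (fun t => (f t).1) f'.1 s :=
  (ContinuousLinearMap.fst ℝ E E').hasFDerivAt.comp_hasDerivAt s h

theorem hasDerivAt_snd {E E' : Type*} [NormedAddCommGroup E] [NormedSpace ℝ E]
    [NormedAddCommGroup E'] [NormedSpace ℝ E'] {f : ℝ → E × E'} {f' : E × E'} {s : ℝ}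
    (h : HasDerivAt f f' s) : HasDerivAt (fun t => (f t).2) f'.2 s :=
  (ContinuousLinearMap.snd ℝ E E').hasFDerivAt.comp_hasDerivAt s h

/-- An integral curve of `arcField` gives a projective arc, after a change of the time scale. -/
theorem exists_arc_of_integralCurve (hF : IsLocalFinsler U F) {T ε : ℝ} (hT : 0 < T) (hTε : T < ε)
    {z : EuclideanSpace ℝ (Fin n) × EuclideanSpace ℝ (Fin n)} (hz : z ∈ slit U)
    {α : ℝ → ArcState n} (h0 : α 0 = arcInit F z)
    (hα : ∀ t ∈ Ioo (-ε) ε, α t ∈ arcDomain U ∧ HasDerivAt α (arcField F (α t)) t) :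
    ∃ (J : Set ℝ) (X : ℝ → EuclideanSpace ℝ (Fin n)) (P : ℝ → ℝ), IsCoordProjectiveArc U F J X P ∧
      (∃ s ∈ J, X s = z.1) ∧ ∃ s ∈ J, X s = (α T).1 := by
  have hε : 0 < ε := hT.trans hTε
  set l := F z with hl
  have hlpos : 0 < l := hF.pos hz
  have hl0 : l ≠ 0 := hlpos.ne'
  have hz0 : (0 : ℝ) ∈ Ioo (-ε) ε := ⟨by linarith, hε⟩
  have hlam : ∀ t ∈ Ioo (-ε) ε, (α t).2.2.1 = l := by
    intro t ht
    have hd : ∀ t ∈ Ioo (-ε) ε, HasDerivAt (fun t => (α t).2.2.1) 0 t := fun t ht =>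
      hasDerivAt_fst (hasDerivAt_snd (hasDerivAt_snd (hα t ht).2))
    have := isOpen_Ioo.is_const_of_deriv_eq_zero isPreconnected_Ioo
      (fun s hs => (hd s hs).differentiableAt.differentiableWithinAt)
      (fun s hs => (hd s hs).deriv) ht hz0
    rw [this, h0]
    rfl
  have hscale : ∀ s ∈ Ioo (-(l * ε)) (l * ε), l⁻¹ * s ∈ Ioo (-ε) ε := fun s hs => by
    rw [mem_Ioo, ← abs_lt] at hs ⊢
    rw [abs_mul, abs_of_pos (inv_pos.2 hlpos), inv_mul_lt_iff₀ hlpos]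
    exact hs
  -- Running time at rate 1/l cancels the speed l and leaves the unit direction as velocity.
  set β : ℝ → ArcState n := fun s => α (l⁻¹ * s) with hβ
  have hβd : ∀ s ∈ Ioo (-(l * ε)) (l * ε), HasDerivAt β (l⁻¹ • arcField F (β s)) s := fun s hs => by
    have h1 : HasDerivAt (fun s : ℝ => l⁻¹ * s) l⁻¹ s := by
      simpa using (hasDerivAt_id s).const_mul l⁻¹
    exact (hα _ (hscale s hs)).2.scomp s h1
  have hβl : ∀ s ∈ Ioo (-(l * ε)) (l * ε), (β s).2.2.1 = l := fun s hs => hlam _ (hscale s hs)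
  have hβmem : ∀ s ∈ Ioo (-(l * ε)) (l * ε), β s ∈ arcDomain U := fun s hs =>
    (hα _ (hscale s hs)).1
  have hβ0 : β 0 = arcInit F z := by simp only [hβ, mul_zero, h0]
  have hβs : ContDiffOn ℝ ∞ β (Ioo (-(l * ε)) (l * ε)) :=
    contDiffOn_of_hasDerivAt (hF.contDiffOn_arcField.const_smul l⁻¹) isOpen_Ioo hβmem hβd
  -- This intermediate time keeps the end point l T inside the arc, while the solution continues
  -- past both ends, as the normalization of p needs.
  have hmid : (T + ε) / 2 < ε := by linarith
  obtain ⟨P, hP⟩ := isCoordProjectiveArc_of_hasDerivAt hF (η := l * ε) (δ := l * ((T + ε) / 2))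
    (X := fun s => (β s).1) (Y := fun s => (β s).2.1) (a := fun s => (β s).2.2.2.1)
    (b := fun s => (β s).2.2.2.2.1) (p := fun s => (β s).2.2.2.2.2) (by positivity) (by gcongr)
    (fun s hs => (hβmem s hs).1) (fun s hs => (hβmem s hs).2)
    (fun s hs => by
      have h := hasDerivAt_fst (hβd s hs)
      simpa [arcField, hβl s hs, smul_smul, hl0] using h)
    (fun s hs => by
      have h := hasDerivAt_fst (hasDerivAt_snd (hβd s hs))
      simpa [arcField, hβl s hs, smul_smul, hl0] using h)
    (fun s hs => by
      have h := hasDerivAt_fst (hasDerivAt_snd (hasDerivAt_snd (hasDerivAt_snd (hβd s hs))))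
      simpa [arcField, hβl s hs, hl0] using h)
    (fun s hs => by
      have h := hasDerivAt_fst (hasDerivAt_snd (hasDerivAt_snd (hasDerivAt_snd
        (hasDerivAt_snd (hβd s hs)))))
      simpa [arcField, hβl s hs, hl0] using h)
    (fun s hs => by
      have h := hasDerivAt_snd (hasDerivAt_snd (hasDerivAt_snd (hasDerivAt_snd
        (hasDerivAt_snd (hβd s hs)))))
      simpa [arcField, hβl s hs, hl0] using h)
    (contDiff_fst.comp_contDiffOn hβs)
    ((by fun_prop : ContDiff ℝ ∞ fun w : ArcState n => w.2.2.2.2.2).comp_contDiffOn hβs)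
    (by
      simp only [hβ0, arcInit]
      rw [hF.homogeneous z hz _ (inv_pos.2 hlpos), ← hl]
      simp [hl0])
  refine ⟨_, _, P, hP, ⟨0, ⟨?_, ?_⟩, ?_⟩, ⟨l * T, ⟨?_, ?_⟩, ?_⟩⟩
  · have : 0 < l * ((T + ε) / 2) := by positivity
    linarith
  · positivity
  · simp only [hβ0, arcInit]
  · have : 0 < l * ((T + ε) / 2) := by positivity
    have : 0 < l * T := by positivity
    linarith
  · gcongr
    linarith
  · simp only [hβ, inv_mul_cancel_left₀ hl0]

/-- In coordinates, all points near `x₀` are joined to one and the same point by projective arcs. -/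
theorem IsLocalFinsler.exists_eventually_arc (hn : 0 < n) (hF : IsLocalFinsler U F)
    {x₀ : EuclideanSpace ℝ (Fin n)} (hx₀ : x₀ ∈ U) :
    ∃ x₁ : EuclideanSpace ℝ (Fin n), ∀ᶠ x' in 𝓝 x₀,
      ∃ (J : Set ℝ) (X : ℝ → EuclideanSpace ℝ (Fin n)) (P : ℝ → ℝ),
        IsCoordProjectiveArc U F J X P ∧ (∃ s ∈ J, X s = x₁) ∧ ∃ s ∈ J, X s = x' := by
  set y₀ : EuclideanSpace ℝ (Fin n) := EuclideanSpace.single ⟨0, hn⟩ 1 with hy₀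
  have hy0 : y₀ ≠ 0 := by simp [hy₀]
  have hz : (x₀, y₀) ∈ slit U := ⟨hx₀, hy0⟩
  have hnhds : slit U ∈ 𝓝 (x₀, y₀) := hF.isOpen_slit.mem_nhds hz
  have hpos := hF.pos hz
  have hw₀ : arcInit F (x₀, y₀) ∈ arcDomain U :=
    ⟨⟨hx₀, smul_ne_zero (inv_pos.2 hpos).ne' hy0⟩, one_pos⟩
  have hFs : ContDiffAt ℝ 1 F (x₀, y₀) := (hF.contDiffOn.contDiffAt hnhds).of_le (by simp)
  have hι : ContDiffAt ℝ 1 (arcInit F) (x₀, y₀) := by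
    refine contDiffAt_fst.prodMk (ContDiffAt.prodMk ((hFs.inv hpos.ne').smul contDiffAt_snd)
      (hFs.prodMk ?_))
    exact contDiffAt_const
  have hS : arcDomain U ∈ 𝓝 (arcInit F (x₀, y₀)) := (isOpen_arcDomain hF.isOpen).mem_nhds hw₀
  obtain ⟨T, hT, ε, hTε, x₁, hx₁⟩ := exists_shooting (f := arcField F)
    ((hF.contDiffOn_arcField.contDiffAt hS).of_le
      (show ((2 : ℕ∞) : WithTop ℕ∞) ≤ ((⊤ : ℕ∞) : WithTop ℕ∞) from mod_cast le_top)) hS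
    (ContinuousLinearMap.fst ℝ (EuclideanSpace ℝ (Fin n)) _) hι rfl hnhds (fun z _ => rfl)
    (fun z hz => by
      simp [arcField, arcInit, smul_smul, (hF.pos hz).ne'])
  refine ⟨x₁, hx₁.mono fun x' hx' => ?_⟩
  obtain ⟨v, α, hv, h0, hα, hαT⟩ := hx'
  obtain ⟨J, X, P, hP, h1, h2⟩ := exists_arc_of_integralCurve hF hT hTε hv h0 hα
  exact ⟨J, X, P, hP, h1, by simpa [← hαT] using h2⟩

end LocalArcs

/-! ### Passage between the manifold and coordinates -/

section Charts

open Set Filter Bundle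

variable {n : ℕ} {M : Type*} [TopologicalSpace M] [ChartedSpace (EuclideanSpace ℝ (Fin n)) M]

theorem contMDiff_mk_tangentBundle : ContMDiff
    𝓘(ℝ, EuclideanSpace ℝ (Fin n) × EuclideanSpace ℝ (Fin n)) (𝓡 n).tangent ∞
    (fun z : EuclideanSpace ℝ (Fin n) × EuclideanSpace ℝ (Fin n) =>
      (⟨z.1, z.2⟩ : TangentBundle (𝓡 n) (EuclideanSpace ℝ (Fin n)))) := by
  intro z
  rw [Bundle.contMDiffAt_totalSpace]
  refine ⟨contDiff_fst.contMDiff.contMDiffAt, ?_⟩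
  simp only [trivializationAt_model_space_apply]
  exact contDiff_snd.contMDiff.contMDiffAt

/-- The chain rule for e ∘ e.symm = id gives a left inverse. It ensures that nonzero coordinate
vectors land where F is smooth. -/
theorem mfderiv_chart_symm_injective {e : OpenPartialHomeomorph M (EuclideanSpace ℝ (Fin n))}
    (he : e ∈ IsManifold.maximalAtlas (𝓡 n) ∞ M) {x : EuclideanSpace ℝ (Fin n)}
    (hx : x ∈ e.target) : Function.Injective (mfderiv (𝓡 n) (𝓡 n) e.symm x) := by
  have h1 : MDifferentiableAt (𝓡 n) (𝓡 n) e.symm x :=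
    ((contMDiffOn_symm_of_mem_maximalAtlas he).contMDiffAt
      (e.open_target.mem_nhds hx)).mdifferentiableAt (by simp)
  have h2 : MDifferentiableAt (𝓡 n) (𝓡 n) e (e.symm x) :=
    ((contMDiffOn_of_mem_maximalAtlas he).contMDiffAt
      (e.open_source.mem_nhds (e.map_target hx))).mdifferentiableAt (by simp)
  have h3 := mfderiv_comp x h2 h1
  have h4 : (e ∘ e.symm) =ᶠ[𝓝 x] id := by
    filter_upwards [e.open_target.mem_nhds hx] with y hy using e.right_inv hy
  rw [h4.mfderiv_eq, mfderiv_id] at h3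
  refine Function.LeftInverse.injective (g := mfderiv (𝓡 n) (𝓡 n) e (e.symm x)) fun v => ?_
  exact (congrArg (fun A => A v) h3).symm

/-- The velocity of a curve given in a chart. -/
theorem velocity_chart_symm_comp {e : OpenPartialHomeomorph M (EuclideanSpace ℝ (Fin n))}
    (he : e ∈ IsManifold.maximalAtlas (𝓡 n) ∞ M) {X : ℝ → EuclideanSpace ℝ (Fin n)} {s : ℝ}
    (hX : DifferentiableAt ℝ X s) (hs : X s ∈ e.target) :
    (⟨(e.symm ∘ X) s, mfderiv 𝓘(ℝ, ℝ) (𝓡 n) (e.symm ∘ X) s (1 : ℝ)⟩ : TangentBundle (𝓡 n) M)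
      = ⟨e.symm (X s), mfderiv (𝓡 n) (𝓡 n) e.symm (X s) (deriv X s)⟩ := by
  have h1 : MDifferentiableAt (𝓡 n) (𝓡 n) e.symm (X s) :=
    ((contMDiffOn_symm_of_mem_maximalAtlas he).contMDiffAt
      (e.open_target.mem_nhds hs)).mdifferentiableAt (by simp)
  rw [mfderiv_comp s h1 hX.mdifferentiableAt, mfderiv_eq_fderiv]
  congr 1

theorem velocity_congr {γ γ' : ℝ → M} {s : ℝ} (h : γ =ᶠ[𝓝 s] γ') :
    (⟨γ s, mfderiv 𝓘(ℝ, ℝ) (𝓡 n) γ s (1 : ℝ)⟩ : TangentBundle (𝓡 n) M)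
      = ⟨γ' s, mfderiv 𝓘(ℝ, ℝ) (𝓡 n) γ' s (1 : ℝ)⟩ := by
  have h1 := h.mfderiv_eq (I := 𝓘(ℝ, ℝ)) (I' := 𝓡 n)
  have h2 := h.eq_of_nhds
  refine Bundle.TotalSpace.ext h2 ?_
  exact heq_of_eq (congrArg (fun A : ℝ →L[ℝ] EuclideanSpace ℝ (Fin n) => A 1) h1)

variable [IsManifold (𝓡 n) ∞ M]

theorem contMDiffOn_tangent_chart_symm
    {e : OpenPartialHomeomorph M (EuclideanSpace ℝ (Fin n))}
    (he : e ∈ IsManifold.maximalAtlas (𝓡 n) ∞ M) : ContMDiffOn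
    𝓘(ℝ, EuclideanSpace ℝ (Fin n) × EuclideanSpace ℝ (Fin n)) (𝓡 n).tangent ∞
    (fun z : EuclideanSpace ℝ (Fin n) × EuclideanSpace ℝ (Fin n) =>
      (⟨e.symm z.1, mfderiv (𝓡 n) (𝓡 n) e.symm z.1 z.2⟩ : TangentBundle (𝓡 n) M))
    {z | z.1 ∈ e.target} := by
  have : IsManifold (𝓡 n) 1 M := .of_le (n := ∞) (by simp)
  have h1 := (contMDiffOn_symm_of_mem_maximalAtlas he).contMDiffOn_tangentMapWithin (m := ∞)
    (by simp) e.open_target.uniqueMDiffOn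
  have h2 := h1.comp (contMDiff_mk_tangentBundle (n := n)).contMDiffOn
    (s := {z : EuclideanSpace ℝ (Fin n) × EuclideanSpace ℝ (Fin n) | z.1 ∈ e.target})
    (fun z hz => hz)
  refine h2.congr fun z hz => ?_
  simp only [Function.comp, tangentMapWithin]
  rw [mfderivWithin_of_isOpen e.open_target hz]

theorem FinslerStructure.isLocalFinsler (F : FinslerStructure n M)
    {e : OpenPartialHomeomorph M (EuclideanSpace ℝ (Fin n))}
    (he : e ∈ IsManifold.maximalAtlas (𝓡 n) ∞ M) : IsLocalFinsler e.target (inChart F.toFun e) where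
  isOpen := e.open_target
  nonneg _ := F.nonneg _
  contDiffOn := by
    rw [← contMDiffOn_iff_contDiffOn]
    refine F.smooth.comp ((contMDiffOn_tangent_chart_symm he).mono fun z hz => hz.1) fun z hz => ?_
    intro h0
    exact hz.2 (mfderiv_chart_symm_injective he hz.1
      (h0.trans (map_zero (mfderiv (𝓡 n) (𝓡 n) e.symm z.1)).symm))
  homogeneous z hz t ht := by
    simp only [inChart, pow_one]
    rw [← F.homogeneous _ _ t ht]
    congr 2
    exact map_smul _ _ _
  posDef z hz := F.strongly_convex e he z.1 hz.1 z.2 hz.2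

/-- The Finsler length of the velocity of a curve, computed in a chart. -/
theorem FinslerStructure.velocity_eq_inChart (F : FinslerStructure n M)
    {e : OpenPartialHomeomorph M (EuclideanSpace ℝ (Fin n))}
    (he : e ∈ IsManifold.maximalAtlas (𝓡 n) ∞ M) {γ : ℝ → M} {s : ℝ}
    (hγ : ContMDiffAt 𝓘(ℝ, ℝ) (𝓡 n) ∞ γ s) (hs : γ s ∈ e.source) :
    F.toFun ⟨γ s, mfderiv 𝓘(ℝ, ℝ) (𝓡 n) γ s (1 : ℝ)⟩
      = inChart F.toFun e (e (γ s), deriv (e ∘ γ) s) := by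
  have h1 : γ =ᶠ[𝓝 s] e.symm ∘ (e ∘ γ) := by
    filter_upwards [hγ.continuousAt.preimage_mem_nhds (e.open_source.mem_nhds hs)] with t ht
    exact (e.left_inv ht).symm
  have h2 : DifferentiableAt ℝ (e ∘ γ) s := by
    rw [← mdifferentiableAt_iff_differentiableAt]
    exact (((contMDiffOn_of_mem_maximalAtlas he).contMDiffAt
      (e.open_source.mem_nhds hs)).comp s hγ).mdifferentiableAt (by simp)
  rw [velocity_congr h1, velocity_chart_symm_comp he h2 (e.map_source hs)]
  rfl

/-- Projective arcs in coordinates define projective maps. -/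
theorem exists_isProjectiveMap_of_arc (F : FinslerStructure n M)
    {e : OpenPartialHomeomorph M (EuclideanSpace ℝ (Fin n))}
    (he : e ∈ IsManifold.maximalAtlas (𝓡 n) ∞ M) {J : Set ℝ} {X : ℝ → EuclideanSpace ℝ (Fin n)}
    {p : ℝ → ℝ} (h : IsCoordProjectiveArc e.target (inChart F.toFun e) J X p) :
    ∃ f : ℝ → M, IsProjectiveMap F f ∧ ∀ s ∈ J, p s ∈ Ioo (-1 : ℝ) 1 ∧ f (p s) = e.symm (X s) := by
  have hXd : ∀ s ∈ J, DifferentiableAt ℝ X s := fun s hs =>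
    (h.contDiffOn.contDiffAt (h.isOpen.mem_nhds hs)).differentiableAt (by simp)
  have hsrc : ∀ s ∈ J, (e.symm ∘ X) s ∈ e.source := fun s hs => e.map_target (h.mem s hs)
  have hev : ∀ s ∈ J, e ∘ (e.symm ∘ X) =ᶠ[𝓝 s] X := fun s hs => by
    filter_upwards [h.isOpen.mem_nhds hs] with t ht using e.right_inv (h.mem t ht)
  have hval : ∀ s ∈ J, e ((e.symm ∘ X) s) = X s := fun s hs => (hev s hs).eq_of_nhds
  have hf : ∀ s ∈ J, (e.symm ∘ X ∘ Function.invFunOn p J) (p s) = (e.symm ∘ X) s := fun s hs => by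
    simp only [Function.comp, h.bijOn.injOn.leftInvOn_invFunOn hs]
  refine ⟨e.symm ∘ X ∘ Function.invFunOn p J, ⟨J, e.symm ∘ X, p, h.isOpen, h.ordConnected,
    ⟨?_, ?_, ?_⟩, ⟨h.contDiffOn_param, h.deriv_ne_zero, ?_⟩, h.bijOn, hf⟩,
    fun s hs => ⟨h.bijOn.mapsTo hs, hf s hs⟩⟩
  · exact (contMDiffOn_symm_of_mem_maximalAtlas he).comp h.contDiffOn.contMDiffOn h.mem
  · intro s hs
    rw [velocity_chart_symm_comp he (hXd s hs) (h.mem s hs)]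
    exact h.unit_speed s hs
  · intro s hs
    refine ⟨e, he, hsrc s hs, fun i => ?_⟩
    rw [(hev s hs).deriv.deriv_eq, (hev s hs).deriv_eq, hval s hs]
    exact h.geodesic s hs i
  · intro s hs
    refine ⟨e, he, hsrc s hs, ?_⟩
    rw [(hev s hs).deriv_eq, hval s hs]
    exact h.schwarzian_eq s hs

end Charts

/-! ### Chains of geodesic segments: symmetry, triangle inequality, finiteness -/

section Chains

variable {n : ℕ} {M : Type*} [TopologicalSpace M] [ChartedSpace (EuclideanSpace ℝ (Fin n)) M]
  [IsManifold (𝓡 n) ∞ M] {F : FinslerStructure n M}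

theorem poincareDist_comm (a b : ℝ) : poincareDist a b = poincareDist b a := by
  unfold poincareDist
  rw [← abs_neg, ← Real.log_inv, inv_div]

theorem poincareDist_self (a : ℝ) : poincareDist a a = 0 := by
  unfold poincareDist
  by_cases h : (1 - a) * (1 + a) = 0
  · simp [h]
  · rw [div_self h, Real.log_one, abs_zero]

theorem poincareDist_nonneg (a b : ℝ) : 0 ≤ poincareDist a b := abs_nonneg _

namespace GeodesicChain

theorem length_nonneg {x y : M} (α : GeodesicChain F x y) : 0 ≤ α.length :=
  Finset.sum_nonneg fun _ _ => poincareDist_nonneg _ _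

/-- The chain that consists of a single projective map. -/
def single {f : ℝ → M} (hf : IsProjectiveMap F f) {a b : ℝ} (ha : a ∈ Set.Ioo (-1 : ℝ) 1)
    (hb : b ∈ Set.Ioo (-1 : ℝ) 1) : GeodesicChain F (f a) (f b) where
  k := 1
  one_le := le_rfl
  point i := if i = 0 then f a else f b
  a _ := a
  b _ := b
  f _ := f
  point_zero := rfl
  point_last := rfl
  a_mem _ _ := ha
  b_mem _ _ := hb
  projective _ _ := hf
  map_a i hi := by simp [Nat.lt_one_iff.1 hi]
  map_b i hi := by simp

/-- The reversed chain. -/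
def reverse {x y : M} (α : GeodesicChain F x y) : GeodesicChain F y x where
  k := α.k
  one_le := α.one_le
  point i := α.point (α.k - i)
  -- Each segment keeps its projective map and only swaps its two parameters, so no reversed
  -- geodesic is needed. Segments are numbered up to k - 1 but points up to k, hence the different
  -- shifts.
  a i := α.b (α.k - 1 - i)
  b i := α.a (α.k - 1 - i)
  f i := α.f (α.k - 1 - i)
  point_zero := by simpa using α.point_last
  point_last := by simpa using α.point_zero
  a_mem i hi := α.b_mem _ (by omega)
  b_mem i hi := α.a_mem _ (by omega)
  projective i hi := α.projective _ (by omega)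
  map_a i hi := by
    rw [α.map_b _ (by omega)]
    congr 1
    omega
  map_b i hi := by
    rw [α.map_a _ (by omega)]
    congr 1
    omega

theorem length_reverse {x y : M} (α : GeodesicChain F x y) : α.reverse.length = α.length := by
  unfold length
  rw [← Finset.sum_range_reflect]
  refine Finset.sum_congr rfl fun i hi => ?_
  have hi' : i < α.k := Finset.mem_range.1 hi
  have h : α.k - 1 - (α.k - 1 - i) = i := by omega
  simp only [reverse, h]
  exact poincareDist_comm _ _

/-- Concatenation of chains. -/
def append {x y z : M} (α : GeodesicChain F x y) (β : GeodesicChain F y z) :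
    GeodesicChain F x z where
  k := α.k + β.k
  one_le := α.one_le.trans (Nat.le_add_right _ _)
  point i := if i < α.k then α.point i else β.point (i - α.k)
  a i := if i < α.k then α.a i else β.a (i - α.k)
  b i := if i < α.k then α.b i else β.b (i - α.k)
  f i := if i < α.k then α.f i else β.f (i - α.k)
  point_zero := by
    rw [if_pos (Nat.lt_of_succ_le α.one_le)]
    exact α.point_zero
  point_last := by simpa using β.point_last
  a_mem i hi := by
    split_ifs with h
    · exact α.a_mem i h
    · exact β.a_mem _ (by omega)
  b_mem i hi := by
    split_ifs with h
    · exact α.b_mem i h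
    · exact β.b_mem _ (by omega)
  projective i hi := by
    split_ifs with h
    · exact α.projective i h
    · exact β.projective _ (by omega)
  map_a i hi := by
    split_ifs with h
    · exact α.map_a i h
    · exact β.map_a _ (by omega)
  map_b i hi := by
    by_cases h : i < α.k
    · rw [if_pos h, if_pos h, α.map_b i h]
      split_ifs with h'
      · rfl
      · have : i + 1 = α.k := by omega
        rw [this, α.point_last, Nat.sub_self, β.point_zero]
    · rw [if_neg h, if_neg h, if_neg (by omega), β.map_b _ (by omega)]
      congr 1
      omega

theorem length_append {x y z : M} (α : GeodesicChain F x y) (β : GeodesicChain F y z) :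
    (α.append β).length = α.length + β.length := by
  unfold length
  simp only [append]
  rw [Finset.sum_range_add]
  congr 1
  · refine Finset.sum_congr rfl fun i hi => ?_
    rw [if_pos (Finset.mem_range.1 hi), if_pos (Finset.mem_range.1 hi)]
  · refine Finset.sum_congr rfl fun i hi => ?_
    simp

end GeodesicChain

theorem pseudoDist_comm (x y : M) : pseudoDist F x y = pseudoDist F y x := by
  have h : ∀ x y : M, pseudoDist F x y ≤ pseudoDist F y x := fun x y =>
    le_iInf fun α => (iInf_le _ α.reverse).trans_eq (by rw [α.length_reverse])
  exact le_antisymm (h x y) (h y x)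

theorem pseudoDist_triangle (x y z : M) :
    pseudoDist F x z ≤ pseudoDist F x y + pseudoDist F y z := by
  unfold pseudoDist
  rw [ENNReal.iInf_add]
  refine le_iInf fun α => ?_
  rw [ENNReal.add_iInf]
  refine le_iInf fun β => (iInf_le _ (α.append β)).trans_eq ?_
  rw [α.length_append, ENNReal.ofReal_add α.length_nonneg β.length_nonneg]

/-- Shooting joins an auxiliary point x₁ to all points near x, including x itself; the chain goes
back from x to x₁ and out again. -/
theorem exists_eventually_nonempty_chain (hn : 0 < n) (F : FinslerStructure n M) (x : M) :
    ∀ᶠ y in 𝓝 x, Nonempty (GeodesicChain F x y) := by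
  set e := chartAt (EuclideanSpace ℝ (Fin n)) x with he'
  have he : e ∈ IsManifold.maximalAtlas (𝓡 n) ∞ M := IsManifold.chart_mem_maximalAtlas x
  have hx : x ∈ e.source := mem_chart_source _ x
  obtain ⟨x₁, hx₁⟩ := (F.isLocalFinsler he).exists_eventually_arc hn (e.map_source hx)
  have hchain : ∀ᶠ y in 𝓝 x, Nonempty (GeodesicChain F (e.symm x₁) y) := by
    filter_upwards [(e.continuousAt hx).eventually hx₁, e.open_source.mem_nhds hx] with y hy hys
    obtain ⟨J, X, p, h, ⟨s, hs, hsx⟩, ⟨t, ht, hty⟩⟩ := hy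
    obtain ⟨f, hf, hfp⟩ := exists_isProjectiveMap_of_arc F he h
    have hα := GeodesicChain.single hf (hfp s hs).1 (hfp t ht).1
    rw [(hfp s hs).2, (hfp t ht).2, hsx, hty, e.left_inv hys] at hα
    exact ⟨hα⟩
  obtain ⟨α⟩ := hchain.self_of_nhds
  filter_upwards [hchain] with y ⟨β⟩
  exact ⟨α.reverse.append β⟩

/-- Being joined by a chain is symmetric, transitive and holds locally, so connectedness makes it
global. -/
theorem nonempty_chain [ConnectedSpace M] (hn : 0 < n) (F : FinslerStructure n M) (x y : M) :
    Nonempty (GeodesicChain F x y) :=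
  PreconnectedSpace.induction₂' (fun x y => Nonempty (GeodesicChain F x y))
    (fun x => (exists_eventually_nonempty_chain hn F x).mono fun _ ⟨α⟩ => ⟨⟨α⟩, ⟨α.reverse⟩⟩)
    ⟨fun _ _ _ ⟨α⟩ ⟨β⟩ => ⟨α.append β⟩⟩ x y

theorem pseudoDist_lt_top [ConnectedSpace M] (hn : 0 < n) (x y : M) : pseudoDist F x y < ⊤ := by
  obtain ⟨α⟩ := nonempty_chain hn F x y
  exact (iInf_le _ α).trans_lt ENNReal.ofReal_lt_top

/-- Chains have at least one segment, so a projective map through x is required; one is borrowed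
from any chain starting at x and used with equal parameters. -/
theorem pseudoDist_self [ConnectedSpace M] (hn : 0 < n) (x : M) : pseudoDist F x x = 0 := by
  obtain ⟨α⟩ := nonempty_chain hn F x x
  have h0 : 0 < α.k := α.one_le
  have hx : α.f 0 (α.a 0) = x := by rw [α.map_a 0 h0, α.point_zero]
  have h : pseudoDist F (α.f 0 (α.a 0)) (α.f 0 (α.a 0)) ≤ 0 := by
    refine (iInf_le _ (GeodesicChain.single (α.projective 0 h0) (α.a_mem 0 h0)
      (α.a_mem 0 h0))).trans ?_
    simp [GeodesicChain.length, GeodesicChain.single, poincareDist_self]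
  rw [hx] at h
  exact le_antisymm h bot_le

end Chains

/-! ### A Schwarz lemma for projective parameters -/

section SchwarzLemma

open Set Filter

/-- The second derivative test at a local maximum. -/
theorem deriv_deriv_nonpos_of_isLocalMax {ψ ψ' : ℝ → ℝ} {ψ'' s : ℝ} (hmax : IsLocalMax ψ s)
    (h1 : ∀ᶠ t in 𝓝 s, HasDerivAt ψ (ψ' t) t) (h2 : HasDerivAt ψ' ψ'' s) : ψ'' ≤ 0 := by
  by_contra! hpos
  have hd : deriv ψ =ᶠ[𝓝 s] ψ' := h1.mono fun t ht => ht.deriv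
  have hdd : deriv (deriv ψ) s = ψ'' := (h2.congr_of_eventuallyEq hd).deriv
  -- A positive second derivative would make the maximum also a minimum, so ψ would be locally
  -- constant.
  have hmin : IsLocalMin ψ s := isLocalMin_of_deriv_deriv_pos (by rwa [hdd]) hmax.deriv_eq_zero
    h1.self_of_nhds.continuousAt
  have hconst : ψ =ᶠ[𝓝 s] fun _ => ψ s := by
    filter_upwards [hmax, hmin] with t ht ht' using le_antisymm ht ht'
  have h0 : deriv (deriv ψ) s = 0 := by
    rw [hconst.deriv.deriv_eq]
    simp
  linarith

/-- A Schwarz lemma of Ahlfors' type for parameters with negative Schwarzian derivative. -/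
theorem mul_sq_le_of_schwarzian_le {J : Set ℝ} {p p₁ p₂ p₃ : ℝ → ℝ} {κ : ℝ} (hJ : IsOpen J)
    (hJc : J.OrdConnected) (h1 : ∀ s ∈ J, HasDerivAt p (p₁ s) s)
    (h2 : ∀ s ∈ J, HasDerivAt p₁ (p₂ s) s) (h3 : ∀ s ∈ J, HasDerivAt p₂ (p₃ s) s)
    (hpos : ∀ s ∈ J, 0 < p₁ s) (hbij : BijOn p J (Ioo (-1) 1)) (hκ : 0 ≤ κ)
    (hS : ∀ s ∈ J, p₃ s / p₁ s - 3 / 2 * (p₂ s / p₁ s) ^ 2 ≤ -κ) {s₀ : ℝ} (hs₀ : s₀ ∈ J) :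
    κ * (1 - p s₀ ^ 2) ^ 2 ≤ 2 * p₁ s₀ ^ 2 := by
  have hmono : StrictMonoOn p J := by
    refine strictMonoOn_of_deriv_pos hJc.convex
      (fun s hs => (h1 s hs).continuousAt.continuousWithinAt) fun s hs => ?_
    have hs' := interior_subset hs
    rw [(h1 s hs').deriv]
    exact hpos s hs'
  -- Replacing 1 by r < 1 makes ψ vanish at the ends of a compact interval, so its maximum is
  -- attained inside.
  have hr : ∀ r : ℝ, |p s₀| < r → r < 1 → κ * (r ^ 2 - p s₀ ^ 2) ^ 2 ≤ 2 * p₁ s₀ ^ 2 := by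
    intro r hr0 hr1
    have hrpos : 0 < r := (abs_nonneg _).trans_lt hr0
    obtain ⟨c, hc, hpc⟩ := hbij.surjOn (show -r ∈ Ioo (-1 : ℝ) 1 from ⟨by linarith, by linarith⟩)
    obtain ⟨d, hd, hpd⟩ := hbij.surjOn (show r ∈ Ioo (-1 : ℝ) 1 from ⟨by linarith, hr1⟩)
    rw [abs_lt] at hr0
    have hcs : c < s₀ := (hmono.lt_iff_lt hc hs₀).1 (by linarith)
    have hsd : s₀ < d := (hmono.lt_iff_lt hs₀ hd).1 (by linarith)
    have hsub : Icc c d ⊆ J := hJc.out hc hd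
    set ψ : ℝ → ℝ := fun s => (r ^ 2 - p s ^ 2) / p₁ s with hψ
    set ψ' : ℝ → ℝ := fun s => -2 * p s - (r ^ 2 - p s ^ 2) * p₂ s / p₁ s ^ 2 with hψ'
    have hψd : ∀ s ∈ J, HasDerivAt ψ (ψ' s) s := fun s hs => by
      have hne := (hpos s hs).ne'
      refine (((((h1 s hs).pow 2).const_sub (r ^ 2)).div (h2 s hs) hne)).congr_deriv ?_
      simp only [hψ', Pi.pow_apply]
      field_simp
      ring
    have hcont : ContinuousOn ψ (Icc c d) := fun s hs =>
      (hψd s (hsub hs)).continuousAt.continuousWithinAt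
    obtain ⟨m, hm, hmax⟩ := isCompact_Icc.exists_isMaxOn ⟨s₀, hcs.le, hsd.le⟩ hcont
    have hψs : 0 < ψ s₀ := div_pos (by nlinarith) (hpos s₀ hs₀)
    have hψm : ψ s₀ ≤ ψ m := hmax ⟨hcs.le, hsd.le⟩
    have hmc : m ≠ c := by
      rintro rfl
      have : ψ m = 0 := by simp [hψ, hpc]
      linarith
    have hmd : m ≠ d := by
      rintro rfl
      have : ψ m = 0 := by simp [hψ, hpd]
      linarith
    have hm' : m ∈ Ioo c d := ⟨lt_of_le_of_ne hm.1 hmc.symm, lt_of_le_of_ne hm.2 hmd⟩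
    have hmJ : m ∈ J := hsub hm
    have hloc : IsLocalMax ψ m := hmax.isLocalMax (Icc_mem_nhds hm'.1 hm'.2)
    have hzero : ψ' m = 0 := hloc.hasDerivAt_eq_zero (hψd m hmJ)
    have hP := hpos m hmJ
    have hne := hP.ne'
    have hψ'd := ((h1 m hmJ).const_mul (-2)).fun_sub
      ((((((h1 m hmJ).fun_pow 2).const_sub (r ^ 2))).fun_mul (h3 m hmJ)).fun_div
        ((h2 m hmJ).fun_pow 2) (pow_ne_zero 2 hne))
    have hnonpos := deriv_deriv_nonpos_of_isLocalMax hloc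
      (by filter_upwards [hJ.mem_nhds hmJ] with t ht using hψd t ht) hψ'd
    set q := r ^ 2 - p m ^ 2 with hq
    have hqpos : 0 < q := by
      have h5 : 0 < q / p₁ m := lt_of_lt_of_le hψs hψm
      exact (div_pos_iff_of_pos_right hP).1 h5
    set a := p₂ m / p₁ m with ha
    set S := p₃ m / p₁ m - 3 / 2 * (p₂ m / p₁ m) ^ 2 with hSdef
    have hp2 : p₂ m = a * p₁ m := by rw [ha]; field_simp
    have hp3 : p₃ m = (S + 3 / 2 * a ^ 2) * p₁ m := by rw [hSdef, ha]; field_simp; ring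
    have hz : 2 * p m * p₁ m = -(q * a) := by
      have h5 : -2 * p m - q * p₂ m / p₁ m ^ 2 = 0 := hzero
      rw [hp2] at h5
      field_simp at h5
      linarith
    -- Multiply ψ'' ≤ 0 by q p' > 0. The critical point equation replaces q²a² by 4p²p'², and q + p²
    -- = r² collects the terms.
    have hkey : κ * q ^ 2 ≤ 2 * r ^ 2 * p₁ m ^ 2 := by
      have hSm : S ≤ -κ := hS m hmJ
      rw [hp2, hp3] at hnonpos
      have h6 := mul_nonpos_of_nonpos_of_nonneg hnonpos (mul_pos hqpos hP).le
      have h7 : -2 * p₁ m ^ 2 * q + (2 * p m * p₁ m) * a * q - q ^ 2 * (S - a ^ 2 / 2) ≤ 0 := by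
        refine le_of_eq_of_le ?_ h6
        field_simp
        ring
      have h8 : q ^ 2 * a ^ 2 = 4 * p m ^ 2 * p₁ m ^ 2 := by
        linear_combination (-(2 * p m * p₁ m) + q * a) * hz
      rw [hz] at h7
      have h9 : r ^ 2 = q + p m ^ 2 := by rw [hq]; ring
      rw [h9]
      nlinarith [mul_le_mul_of_nonneg_left hSm (sq_nonneg q)]
    have h10 : κ * ψ m ^ 2 ≤ 2 := by
      have : κ * ψ m ^ 2 = κ * q ^ 2 / p₁ m ^ 2 := by simp only [hψ, ← hq, div_pow]; ring
      rw [this, div_le_iff₀ (by positivity)]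
      have : r ^ 2 ≤ 1 := by nlinarith
      nlinarith [sq_nonneg (p₁ m)]
    have h11 : κ * ψ s₀ ^ 2 ≤ 2 :=
      le_trans (mul_le_mul_of_nonneg_left (pow_le_pow_left₀ hψs.le hψm 2) hκ) h10
    have h12 : κ * ψ s₀ ^ 2 = κ * (r ^ 2 - p s₀ ^ 2) ^ 2 / p₁ s₀ ^ 2 := by
      simp only [hψ, div_pow]; ring
    rwa [h12, div_le_iff₀ (pow_pos (hpos s₀ hs₀) 2)] at h11
  have hlt : |p s₀| < 1 := abs_lt.2 (hbij.mapsTo hs₀)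
  have hlim : Tendsto (fun r : ℝ => κ * (r ^ 2 - p s₀ ^ 2) ^ 2) (𝓝[<] 1)
      (𝓝 (κ * (1 ^ 2 - p s₀ ^ 2) ^ 2)) :=
    ((by fun_prop : Continuous fun r : ℝ => κ * (r ^ 2 - p s₀ ^ 2) ^ 2).tendsto 1).mono_left
      nhdsWithin_le_nhds
  have := le_of_tendsto hlim (b := 2 * p₁ s₀ ^ 2) (by
    filter_upwards [self_mem_nhdsWithin, mem_nhdsWithin_of_mem_nhds (lt_mem_nhds hlt)] with r h h'
    exact hr r h' h)
  simpa using this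

/-- The function log((1 + u)/(1 - u)) is an arc length coordinate for ρ, so lower bounds on its
derivative along p integrate to lower bounds on ρ. -/
theorem poincareDist_eq_abs_sub {a b : ℝ} (ha : a ∈ Ioo (-1 : ℝ) 1) (hb : b ∈ Ioo (-1 : ℝ) 1) :
    poincareDist a b = |(Real.log (1 + b) - Real.log (1 - b))
      - (Real.log (1 + a) - Real.log (1 - a))| := by
  have h1 : 1 - a ≠ 0 := by linarith [ha.2]
  have h2 : 1 + a ≠ 0 := by linarith [ha.1]
  have h3 : 1 - b ≠ 0 := by linarith [hb.2]
  have h4 : 1 + b ≠ 0 := by linarith [hb.1]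
  rw [poincareDist, Real.log_div (mul_ne_zero h1 h4) (mul_ne_zero h3 h2), Real.log_mul h1 h4,
    Real.log_mul h3 h2]
  congr 1
  ring

/-- The Poincaré distance of parameters controls the arc length. -/
theorem mul_abs_sub_le_poincareDist_of_pos {J : Set ℝ} {p p₁ p₂ p₃ : ℝ → ℝ} {k : ℝ} (hJ : IsOpen J)
    (hJc : J.OrdConnected) (h1 : ∀ s ∈ J, HasDerivAt p (p₁ s) s)
    (h2 : ∀ s ∈ J, HasDerivAt p₁ (p₂ s) s) (h3 : ∀ s ∈ J, HasDerivAt p₂ (p₃ s) s)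
    (hpos : ∀ s ∈ J, 0 < p₁ s) (hbij : BijOn p J (Ioo (-1) 1))
    (hS : ∀ s ∈ J, p₃ s / p₁ s - 3 / 2 * (p₂ s / p₁ s) ^ 2 ≤ -(k ^ 2 / 2)) {s t : ℝ} (hs : s ∈ J)
    (ht : t ∈ J) : k * |t - s| ≤ poincareDist (p s) (p t) := by
  set σ : ℝ → ℝ := fun s => Real.log (1 + p s) - Real.log (1 - p s) with hσ
  have hσd : ∀ s ∈ J, HasDerivAt σ (p₁ s / (1 + p s) - -p₁ s / (1 - p s)) s := fun s hs => by
    have hm := hbij.mapsTo hs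
    exact (((h1 s hs).const_add 1).log (by linarith [hm.1])).fun_sub
      (((h1 s hs).const_sub 1).log (by linarith [hm.2]))
  have hle : ∀ s ∈ J, k ≤ deriv σ s := fun s hs => by
    have hm := hbij.mapsTo hs
    have e1 : 0 < 1 + p s := by linarith [hm.1]
    have e2 : 0 < 1 - p s := by linarith [hm.2]
    have e3 : 0 < 1 - p s ^ 2 := by nlinarith
    have hS' := mul_sq_le_of_schwarzian_le hJ hJc h1 h2 h3 hpos hbij (by positivity) hS hs
    have e4 : (k * (1 - p s ^ 2)) ^ 2 ≤ (2 * p₁ s) ^ 2 := by nlinarith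
    have e5 : k * (1 - p s ^ 2) ≤ 2 * p₁ s :=
      le_of_sq_le_sq e4 (by linarith [hpos s hs])
    rw [(hσd s hs).deriv]
    have e6 : p₁ s / (1 + p s) - -p₁ s / (1 - p s) = 2 * p₁ s / (1 - p s ^ 2) := by
      have : 1 - p s ^ 2 = (1 + p s) * (1 - p s) := by ring
      rw [this]
      field_simp
      ring
    rwa [e6, le_div_iff₀ e3]
  have hincr : ∀ s ∈ J, ∀ t ∈ J, s ≤ t → k * (t - s) ≤ σ t - σ s :=
    hJc.convex.mul_sub_le_image_sub_of_le_deriv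
      (fun s hs => (hσd s hs).continuousAt.continuousWithinAt)
      (fun s hs => (hσd s (interior_subset hs)).differentiableAt.differentiableWithinAt)
      (fun s hs => hle s (interior_subset hs))
  rw [poincareDist_eq_abs_sub (hbij.mapsTo hs) (hbij.mapsTo ht)]
  rcases le_total s t with h | h
  · rw [abs_of_nonneg (sub_nonneg.2 h)]
    exact (hincr s hs t ht h).trans (le_abs_self _)
  · rw [abs_sub_comm, abs_of_nonneg (sub_nonneg.2 h), abs_sub_comm]
    exact (hincr t ht s hs h).trans (le_abs_self _)

theorem poincareDist_neg (a b : ℝ) : poincareDist (-a) (-b) = poincareDist a b := by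
  rw [poincareDist_comm]
  unfold poincareDist
  congr 2
  ring

/-- A nonvanishing p' has constant sign on the interval. If it is negative, pass to -p: the
Schwarzian and ρ are unchanged. -/
theorem mul_abs_sub_le_poincareDist {J : Set ℝ} {p : ℝ → ℝ} {k : ℝ} (hJ : IsOpen J)
    (hJc : J.OrdConnected) (hp : ContDiffOn ℝ ∞ p J) (hne : ∀ s ∈ J, deriv p s ≠ 0)
    (hbij : BijOn p J (Ioo (-1) 1))
    (hS : ∀ s ∈ J, schwarzian p s ≤ -(k ^ 2 / 2)) {s t : ℝ} (hs : s ∈ J)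
    (ht : t ∈ J) : k * |t - s| ≤ poincareDist (p s) (p t) := by
  have hD : ∀ {q : ℝ → ℝ}, ContDiffOn ℝ ∞ q J → ContDiffOn ℝ ∞ (deriv q) J ∧
      ∀ s ∈ J, HasDerivAt q (deriv q s) s := fun hq =>
    ⟨hq.deriv_of_isOpen hJ (by simp), fun s hs =>
      ((hq.contDiffAt (hJ.mem_nhds hs)).differentiableAt (by simp)).hasDerivAt⟩
  obtain ⟨hp1, h1⟩ := hD hp
  obtain ⟨hp2, h2⟩ := hD hp1
  obtain ⟨hp3, h3⟩ := hD hp2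
  by_cases hsign : ∀ s ∈ J, 0 < deriv p s
  · exact mul_abs_sub_le_poincareDist_of_pos hJ hJc h1 h2 h3 hsign hbij hS hs ht
  · have hneg : ∀ s ∈ J, deriv p s < 0 := by
      push Not at hsign
      obtain ⟨u, hu, hu0⟩ := hsign
      intro v hv
      by_contra! hv0
      obtain ⟨w, hw, hw0⟩ := hJc.isPreconnected.intermediate_value hu hv hp1.continuousOn
        (show (0 : ℝ) ∈ Icc _ _ from ⟨hu0, hv0⟩)
      exact hne w hw hw0
    have hbij' : BijOn (fun s => -p s) J (Ioo (-1) 1) := by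
      refine ⟨fun s hs => ?_, fun s hs t ht hst => hbij.injOn hs ht (neg_injective hst),
        fun a ha => ?_⟩
      · have := hbij.mapsTo hs
        exact ⟨by linarith [this.2], by linarith [this.1]⟩
      · obtain ⟨s, hs, hsa⟩ := hbij.surjOn
          (show -a ∈ Ioo (-1 : ℝ) 1 from ⟨by linarith [ha.2], by linarith [ha.1]⟩)
        exact ⟨s, hs, by simp [hsa]⟩
    have := mul_abs_sub_le_poincareDist_of_pos (p := fun s => -p s) hJ hJc
      (fun s hs => (h1 s hs).fun_neg) (fun s hs => (h2 s hs).fun_neg)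
      (fun s hs => (h3 s hs).fun_neg) (fun s hs => by simpa using hneg s hs) hbij'
      (fun s hs => by simpa only [neg_div_neg_eq, schwarzian] using hS s hs) hs ht
    rwa [poincareDist_neg] at this

end SchwarzLemma

/-! ### Distinct points have positive distance -/

section Separation

open Set Filter

variable {n : ℕ} {M : Type*} [TopologicalSpace M] [ChartedSpace (EuclideanSpace ℝ (Fin n)) M]
  [IsManifold (𝓡 n) ∞ M] {F : FinslerStructure n M}

/-- Homogeneity with factor 2 at the zero vector. It serves to show that unit vectors are nonzero,
so that they lie in the slit domain. -/
theorem FinslerStructure.inChart_zero (F : FinslerStructure n M)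
    (e : OpenPartialHomeomorph M (EuclideanSpace ℝ (Fin n))) (x : EuclideanSpace ℝ (Fin n)) :
    inChart F.toFun e (x, 0) = 0 := by
  have h : F.toFun ⟨e.symm x, (2 : ℝ) • (0 : TangentSpace (𝓡 n) (e.symm x))⟩
      = 2 * F.toFun ⟨e.symm x, 0⟩ := F.homogeneous _ _ 2 two_pos
  rw [smul_zero] at h
  have h2 : inChart F.toFun e (x, 0) = F.toFun ⟨e.symm x, 0⟩ := by
    unfold inChart
    congr 2
    exact map_zero (mfderiv (𝓡 n) (𝓡 n) e.symm x)
  linarith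

/-- Along a unit speed geodesic, the right hand side of the equation of projective parameters is
bounded in terms of the bound on the Ricci tensor. -/
theorem projectiveRHS_le {c : ℝ} (hn : 2 ≤ n) (hRic : RicciLE F (-c ^ 2))
    {e : OpenPartialHomeomorph M (EuclideanSpace ℝ (Fin n))}
    (he : e ∈ IsManifold.maximalAtlas (𝓡 n) ∞ M)
    {z : EuclideanSpace ℝ (Fin n) × EuclideanSpace ℝ (Fin n)} (hz : z.1 ∈ e.target)
    (h1 : inChart F.toFun e z = 1) :
    projectiveRHS (inChart F.toFun e) z ≤ -((2 * c / √((n : ℝ) - 1)) ^ 2 / 2) := by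
  have hn1 : (0 : ℝ) < (n : ℝ) - 1 := by
    have : (2 : ℝ) ≤ n := by exact_mod_cast hn
    linarith
  have hy : z.2 ≠ 0 := fun h => by
    have : z = (z.1, 0) := Prod.ext rfl h
    rw [this, F.inChart_zero] at h1
    exact zero_ne_one h1
  have hg := (F.isLocalFinsler he).sum_sum_fundamentalTensor (z := z) ⟨hz, hy⟩
  have hR := (hRic e he z.1 hz z.2 hy).dotProduct_mulVec_nonneg z.2.ofLp
  have hsum : star z.2.ofLp ⬝ᵥ ((-c ^ 2 • fundamentalTensor (inChart F.toFun e) (z.1, z.2)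
        - ricciTensor (inChart F.toFun e) (z.1, z.2)).mulVec z.2.ofLp)
      = -c ^ 2 * ∑ i, ∑ j, fundamentalTensor (inChart F.toFun e) z i j * z.2 i * z.2 j
        - ∑ j, ∑ k, ricciTensor (inChart F.toFun e) z j k * z.2 j * z.2 k := by
    simp only [dotProduct, Matrix.mulVec, Finset.mul_sum, ← Finset.sum_sub_distrib]
    refine Finset.sum_congr rfl fun i _ => Finset.sum_congr rfl fun j _ => ?_
    simp
    ring
  rw [hsum, hg, h1] at hR
  have hle : ∑ j, ∑ k, ricciTensor (inChart F.toFun e) z j k * z.2 j * z.2 k ≤ -c ^ 2 := by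
    linarith
  unfold projectiveRHS
  -- The constant k = 2c/√(n-1) is the one with k²/2 = 2c²/(n-1).
  calc _ ≤ 2 / ((n : ℝ) - 1) * (-c ^ 2) := by gcongr
    _ = _ := by
      rw [div_pow, Real.sq_sqrt hn1.le]
      ring

/-- Arc length along a projective map is controlled by the Poincaré distance. -/
theorem IsProjectiveMap.exists_geodesic {c : ℝ} (hn : 2 ≤ n) (hRic : RicciLE F (-c ^ 2))
    {f : ℝ → M} (hf : IsProjectiveMap F f) {a b : ℝ} (ha : a ∈ Ioo (-1 : ℝ) 1)
    (hb : b ∈ Ioo (-1 : ℝ) 1) :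
    ∃ (J : Set ℝ) (γ : ℝ → M) (s t : ℝ), IsOpen J ∧ J.OrdConnected ∧ IsArcLengthGeodesicOn F γ J ∧
      s ∈ J ∧ t ∈ J ∧ f a = γ s ∧ f b = γ t ∧
      2 * c / √((n : ℝ) - 1) * |t - s| ≤ poincareDist a b := by
  obtain ⟨J, γ, p, hJ, hJc, hγ, hp, hbij, hfp⟩ := hf
  obtain ⟨s, hs, rfl⟩ := hbij.surjOn ha
  obtain ⟨t, ht, rfl⟩ := hbij.surjOn hb
  refine ⟨J, γ, s, t, hJ, hJc, hγ, hs, ht, hfp s hs, hfp t ht,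
    mul_abs_sub_le_poincareDist hJ hJc hp.smooth hp.deriv_ne_zero hbij (fun u hu => ?_) hs ht⟩
  obtain ⟨e, he, hsrc, heq⟩ := hp.schwarzian_eq u hu
  rw [heq]
  refine projectiveRHS_le hn hRic he (z := (e (γ u), deriv (e ∘ γ) u)) (e.map_source hsrc) ?_
  rw [← F.velocity_eq_inChart he (hγ.smooth.contMDiffAt (hJ.mem_nhds hu)) hsrc]
  exact hγ.unit_speed u hu

/-- Over a compact set, a smooth function on a chart domain has differential bounded by the Finsler
function. -/
theorem IsLocalFinsler.exists_fderiv_le {U : Set (EuclideanSpace ℝ (Fin n))}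
    {G : EuclideanSpace ℝ (Fin n) × EuclideanSpace ℝ (Fin n) → ℝ} (hG : IsLocalFinsler U G)
    {K : Set (EuclideanSpace ℝ (Fin n))} (hK : IsCompact K) (hKU : K ⊆ U)
    {H : EuclideanSpace ℝ (Fin n) → ℝ} (hH : ContDiffOn ℝ ∞ H U) :
    ∃ C, 0 ≤ C ∧ ∀ x ∈ K, ∀ y ≠ 0, |fderiv ℝ H x y| ≤ C * G (x, y) := by
  -- The quotient dH(y)/F is homogeneous of degree zero in y, so it suffices to bound it on unit
  -- vectors over K, a compact set where F > 0.
  have hcpt : IsCompact (K ×ˢ Metric.sphere (0 : EuclideanSpace ℝ (Fin n)) 1) :=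
    hK.prod (isCompact_sphere _ _)
  have hsub : K ×ˢ Metric.sphere (0 : EuclideanSpace ℝ (Fin n)) 1 ⊆ slit U := fun z hz =>
    ⟨hKU hz.1, ne_zero_of_mem_unit_sphere ⟨z.2, hz.2⟩⟩
  have hcont : ContinuousOn (fun z : EuclideanSpace ℝ (Fin n) × EuclideanSpace ℝ (Fin n) =>
      fderiv ℝ H z.1 z.2 / G z) (K ×ˢ Metric.sphere (0 : EuclideanSpace ℝ (Fin n)) 1) := by
    refine ContinuousOn.div (ContinuousOn.clm_apply ?_ continuousOn_snd)
      (hG.contDiffOn.continuousOn.mono hsub) fun z hz => (hG.pos (hsub hz)).ne'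
    exact (hH.continuousOn_fderiv_of_isOpen hG.isOpen (by simp)).comp continuousOn_fst
      fun z hz => hKU hz.1
  obtain ⟨C, hC⟩ := hcpt.exists_bound_of_continuousOn hcont
  refine ⟨max C 0, le_max_right _ _, fun x hx y hy => ?_⟩
  have hny : 0 < ‖y‖ := norm_pos_iff.2 hy
  have hxy : (x, y) ∈ slit U := ⟨hKU hx, hy⟩
  have hmem : (x, ‖y‖⁻¹ • y) ∈ K ×ˢ Metric.sphere (0 : EuclideanSpace ℝ (Fin n)) 1 := by
    refine ⟨hx, ?_⟩
    simp [norm_smul, hny.ne']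
  have h := hC _ hmem
  have hpos := hG.pos hxy
  have hhom := hG.homogeneous (x, y) hxy _ (inv_pos.2 hny)
  simp only [pow_one] at hhom
  rw [hhom, map_smul, smul_eq_mul, mul_div_mul_left _ _ (inv_pos.2 hny).ne', Real.norm_eq_abs,
    abs_div, abs_of_pos hpos, div_le_iff₀ hpos] at h
  exact h.trans (mul_le_mul_of_nonneg_right (le_max_left _ _) hpos.le)

/-- A bump function is Lipschitz along all unit speed geodesics, with a common constant. -/
theorem exists_bump_lipschitz [T2Space M] (F : FinslerStructure n M) {x : M}
    (h : SmoothBumpFunction (𝓡 n) x) :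
    ∃ C, 0 ≤ C ∧ ∀ (J : Set ℝ) (γ : ℝ → M), IsOpen J → J.OrdConnected →
      IsArcLengthGeodesicOn F γ J → ∀ s ∈ J, ∀ t ∈ J, |h (γ t) - h (γ s)| ≤ C * |t - s| := by
  set e := chartAt (EuclideanSpace ℝ (Fin n)) x with he'
  have he : e ∈ IsManifold.maximalAtlas (𝓡 n) ∞ M := IsManifold.chart_mem_maximalAtlas x
  have hsupp : tsupport h ⊆ e.source := h.tsupport_subset_chartAt_source
  have hK : IsCompact (e '' tsupport h) :=
    h.hasCompactSupport.isCompact.image_of_continuousOn (e.continuousOn.mono hsupp)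
  have hKU : e '' tsupport h ⊆ e.target := by
    rintro _ ⟨z, hz, rfl⟩
    exact e.map_source (hsupp hz)
  have hH : ContDiffOn ℝ ∞ (h ∘ e.symm) e.target := by
    rw [← contMDiffOn_iff_contDiffOn]
    exact h.contMDiff.comp_contMDiffOn (contMDiffOn_symm_of_mem_maximalAtlas he)
  obtain ⟨C, hC0, hC⟩ := (F.isLocalFinsler he).exists_fderiv_le hK hKU hH
  refine ⟨C, hC0, fun J γ hJ hJc hγ s hs t ht => ?_⟩
  have hd : ∀ u ∈ J, DifferentiableAt ℝ (h ∘ γ) u := fun u hu => by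
    rw [← mdifferentiableAt_iff_differentiableAt]
    exact (h.contMDiffAt.comp u (hγ.smooth.contMDiffAt (hJ.mem_nhds hu))).mdifferentiableAt
      (by simp)
  have hbound : ∀ u ∈ J, ‖deriv (h ∘ γ) u‖ ≤ C := by
    intro u hu
    have hγu := hγ.smooth.contMDiffAt (hJ.mem_nhds hu)
    -- Off the support h ∘ γ is locally zero, so the estimate holds even if γ leaves the chart and
    -- returns.
    by_cases hmem : γ u ∈ tsupport h
    · have hsrc : γ u ∈ e.source := hsupp hmem
      have hunit := hγ.unit_speed u hu
      rw [F.velocity_eq_inChart he hγu hsrc] at hunit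
      have hy : deriv (e ∘ γ) u ≠ 0 := fun h0 => by
        rw [h0, F.inChart_zero] at hunit
        exact zero_ne_one hunit
      have hev : h ∘ γ =ᶠ[𝓝 u] (h ∘ e.symm) ∘ (e ∘ γ) := by
        filter_upwards [hγu.continuousAt.preimage_mem_nhds (e.open_source.mem_nhds hsrc)] with v hv
        simp only [Function.comp]
        rw [e.left_inv hv]
      have h2 : DifferentiableAt ℝ (e ∘ γ) u := by
        rw [← mdifferentiableAt_iff_differentiableAt]
        exact (((contMDiffOn_of_mem_maximalAtlas he).contMDiffAt
          (e.open_source.mem_nhds hsrc)).comp u hγu).mdifferentiableAt (by simp)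
      have h3 : DifferentiableAt ℝ (h ∘ e.symm) ((e ∘ γ) u) :=
        (hH.contDiffAt (e.open_target.mem_nhds (e.map_source hsrc))).differentiableAt (by simp)
      have h4 := (h3.hasFDerivAt.comp_hasDerivAt u h2.hasDerivAt).deriv
      rw [hev.deriv_eq, h4, Real.norm_eq_abs]
      refine (hC _ (mem_image_of_mem e hmem) _ hy).trans_eq ?_
      rw [hunit, mul_one]
    · have hev : h ∘ γ =ᶠ[𝓝 u] fun _ => 0 := by
        filter_upwards [hγu.continuousAt.preimage_mem_nhds
          ((isClosed_tsupport h).isOpen_compl.mem_nhds hmem)] with v hv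
        exact image_eq_zero_of_notMem_tsupport (f := h) hv
      rw [hev.deriv_eq]
      simpa using hC0
  exact hJc.convex.norm_image_sub_le_of_norm_deriv_le hd hbound hs ht

theorem pseudoDist_ne_zero [T2Space M] (hn : 2 ≤ n) {c : ℝ} (hc : 0 < c)
    (hRic : RicciLE F (-c ^ 2)) {x y : M} (hxy : x ≠ y) : pseudoDist F x y ≠ 0 := by
  have hn1 : (0 : ℝ) < (n : ℝ) - 1 := by
    have : (2 : ℝ) ≤ n := by exact_mod_cast hn
    linarith
  obtain ⟨h, -, hh⟩ := (SmoothBumpFunction.nhds_basis_tsupport (I := 𝓡 n) x).mem_iff.1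
    (isOpen_ne.mem_nhds hxy)
  have hx : h x = 1 := h.eq_one
  have hy : h y = 0 := image_eq_zero_of_notMem_tsupport fun hmem => hh hmem rfl
  obtain ⟨C, hC0, hC⟩ := exists_bump_lipschitz F h
  set k := 2 * c / √((n : ℝ) - 1) with hk
  have hkpos : 0 < k := by positivity
  -- The bump function drops from 1 to 0 along the chain, and telescoping bounds this drop by the
  -- length. C may be zero, hence C + 1 in the denominator.
  have hchain : ∀ α : GeodesicChain F x y, k / (C + 1) ≤ α.length := by
    intro α
    have hstep : ∀ i < α.k, |h (α.point (i + 1)) - h (α.point i)|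
        ≤ (C + 1) / k * poincareDist (α.a i) (α.b i) := by
      intro i hi
      obtain ⟨J, γ, s, t, hJ, hJc, hγ, hs, ht, hfa, hfb, hle⟩ :=
        (α.projective i hi).exists_geodesic hn hRic (α.a_mem i hi) (α.b_mem i hi)
      rw [← α.map_a i hi, ← α.map_b i hi, hfa, hfb]
      calc _ ≤ C * |t - s| := hC J γ hJ hJc hγ s hs t ht
        _ ≤ (C + 1) * |t - s| := by gcongr; linarith
        _ = (C + 1) / k * (k * |t - s|) := by field_simp
        _ ≤ _ := by gcongr
    have htel : |h (α.point α.k) - h (α.point 0)| ≤ (C + 1) / k * α.length := by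
      rw [← Finset.sum_range_sub (fun i => h (α.point i)), GeodesicChain.length, Finset.mul_sum]
      exact (Finset.abs_sum_le_sum_abs _ _).trans
        (Finset.sum_le_sum fun i hi => hstep i (Finset.mem_range.1 hi))
    rw [α.point_zero, α.point_last, hx, hy, zero_sub, abs_neg, abs_one] at htel
    rw [div_le_iff₀ (by positivity)]
    have : k * 1 ≤ k * ((C + 1) / k * α.length) := mul_le_mul_of_nonneg_left htel hkpos.le
    calc k = k * 1 := (mul_one k).symm
      _ ≤ _ := this
      _ = α.length * (C + 1) := by field_simp
  have hle : ENNReal.ofReal (k / (C + 1)) ≤ pseudoDist F x y :=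
    le_iInf fun α => ENNReal.ofReal_le_ofReal (hchain α)
  have hpos : 0 < ENNReal.ofReal (k / (C + 1)) := ENNReal.ofReal_pos.2 (by positivity)
  exact (hpos.trans_le hle).ne'

end Separation

end Finsler

end

theorem theorem2 {n : ℕ} (hn : 2 ≤ n) {M : Type*} [TopologicalSpace M] [T2Space M]
    [ConnectedSpace M] [ChartedSpace (EuclideanSpace ℝ (Fin n)) M] [IsManifold (𝓡 n) ∞ M]
    (F : Finsler.FinslerStructure n M) (c : ℝ) (hc : 0 < c)
    (hRic : Finsler.RicciLE F (-c ^ 2)) :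
    (∀ x y : M, Finsler.pseudoDist F x y < ⊤) ∧
    (∀ x y : M, Finsler.pseudoDist F x y = 0 ↔ x = y) ∧
    (∀ x y : M, Finsler.pseudoDist F x y = Finsler.pseudoDist F y x) ∧
    (∀ x y z : M, Finsler.pseudoDist F x z
      ≤ Finsler.pseudoDist F x y + Finsler.pseudoDist F y z) :=
  ⟨fun x y => Finsler.pseudoDist_lt_top (by omega) x y,
    fun x y => ⟨fun h => by_contra fun hxy => Finsler.pseudoDist_ne_zero hn hc hRic hxy h,
      fun h => h ▸ Finsler.pseudoDist_self (by omega) x⟩,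
    Finsler.pseudoDist_comm, Finsler.pseudoDist_triangle⟩
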